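/- Fix $R\ge 1$, $\lambda>0$, $\mu_1,\dots,\mu_R>0$, and a vector $p$ of positive integers $p_1,\dots,p_R$ with $\|p\|=\sum_r p_r$. For each $k\ge1$ consider a system with $k$ parallel FCFS queues of each type $r=1,\dots,R$; the queues are indexed by $(r,\kappa)$, $1\le\kappa\le k$. The inter-arrival times $T^{(k)}_n$ ($n\in\mathbb Z$) of jobs at the dispatcher are i.i.d., positive, with mean $1/(\lambda k)$ and $\mathrm{Var}\,T^{(k)}_n=o(1/k)$ as $k\to\infty$. The service times $S^{(k)}_{n,r,\kappa}$ at queue $(r,\kappa)$ are i.i.d., positive, with a law that depends only on $r$ (not on $k$, $\kappa$) and has mean $1/\mu_r$. All these variables are independent. A policy $\pi:\{1,2,\dots\}\to\{1,\dots,R\}\times\{1,\dots,k\}$ sends the $n$-th job to queue $\pi(n)=(\pi_1(n),\pi_2(n))$. Let $\mathcal C_p^{(k)}$ be the set of periodic policies such that $\pi_1$ has period $\|p\|$ with exactly $p_r$ jobs sent to type $r$ per period, for every $r$, and such that the successive jobs sent to type $r$ visit the queues $(r,1),(r,2),\dots,(r,k),(r,1),\dots$ cyclically, starting from $(r,1)$.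 (Thus a proportion $p_r/\|p\|$ of the jobs is sent to the queues of type $r$.) Let $\pi\in\mathcal C_p^{(k)}$ have least period $n^*$, and let $q_{r,\kappa}$ be the proportion of jobs sent to queue $(r,\kappa)$. Extend $\pi$ periodically to $\mathbb Z$. The inter-arrival times at queue $(r,\kappa)$, i.e. the sums of the $T^{(k)}_i$ between successive jobs sent to that queue, form a sequence with a repeated pattern of $n^*q_{r,\kappa}$ terms. Starting it at a uniformly chosen term of the pattern, independently of all the rest, gives a stationary sequence $(T^{(k)}_{n,r,\kappa}(\pi))_{n\in\mathbb Z}$. The stationary waiting time at queue $(r,\kappa)$ is $$W^{(k)}_{r,\kappa}(\pi)=\Big(\sup_{n\ge0}\sum_{m=0}^n\big(S^{(k)}_{-m,r,\kappa}-T^{(k)}_{-m,r,\kappa}(\pi)\big)\Big)^+,$$ and the stationary waiting time of the system is $W^{(k)}(\pi)=\sum_{r,\kappa}\mathbf 1_{\{V\in Q_{r,\kappa}\}}W^{(k)}_{r,\kappa}(\pi)$, where $V$ is uniform on $\{1,\dots,n^*\}$ and independent of all the rest, and $(Q_{r,\kappa})$ is any partition of $\{1,\dots,n^*\}$ with $|Q_{r,\kappa}|=n^*q_{r,\kappa}$;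 so its law is the mixture of the laws of the $W^{(k)}_{r,\kappa}(\pi)$ with weights $q_{r,\kappa}$. Let $W_r(p)$ be the stationary waiting time of the D/GI/1 queue with constant inter-arrival times $\|p\|/(p_r\lambda)$ and i.i.d. service times with the law of type $r$ (the same formula, with these service and inter-arrival times). Let $W(p)=\sum_r\mathbf 1_{\{\overline V=r\}}W_r(p)$ with $\overline V$ independent of all the rest and $\Pr(\overline V=r)=p_r/\|p\|$. **Theorem 1.** Assume $\lambda\,p_r/\|p\|<\mu_r$ for all $r$. Then for every sequence of policies $\pi^{(k)}\in\mathcal C_p^{(k)}$, $k\ge1$, all the suprema above are almost surely finite and $$W^{(k)}(\pi^{(k)})\xrightarrow[k\to\infty]{d}W(p).$$ -/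

import Mathlib

open MeasureTheory ProbabilityTheory Filter
open scoped Topology

namespace ParallelQueues

noncomputable section

/-! ### Dispatching policies

There are `R` types of queues and `k` queues of each type; the queue `(r, κ)` is the `κ`-th queue
of type `r`. Types and queues are numbered from `0` (so queue `0` of `Fin k` is the first queue of
its type), and the jobs arriving at the dispatcher are numbered from `0`. -/

/-- A dispatching rule: `π n` is the queue to which the `n`-th job is routed. -/
abbrev Policy (R k : ℕ) : Type := ℕ → Fin R × Fin k

/-- The `L₁`-norm of a vector of nonnegative integers. -/
def l1norm {R : ℕ} (p : Fin R → ℕ) : ℕ := ∑ r, p r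

/-- The least period `n*` of a policy (`0` if it is not periodic). Every period `N` of a
`q`-policy makes `N q` integral, so this is `min {n ≥ 1 | n q is integral}` whenever that number
is a period of the policy. -/
def period {R k : ℕ} (π : Policy R k) : ℕ :=
  sInf {N : ℕ | 0 < N ∧ ∀ n, π (n + N) = π n}

/-- The number of jobs sent to queue `(r, κ)` in one period. -/
def visitsPerPeriod {R k : ℕ} (π : Policy R k) (r : Fin R) (κ : Fin k) : ℕ :=
  Nat.count (fun n => π n = (r, κ)) (period π)

/-- The set of `q`-policies: the periodic policies that send to each queue `(r, κ)` the
proportion `q r κ` of the jobs of a period. -/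
def qPolicies {R k : ℕ} (q : Fin R → Fin k → ℚ) : Set (Policy R k) :=
  {π | (∃ N : ℕ, 0 < N ∧ ∀ n, π (n + N) = π n) ∧
    ∀ r κ, q r κ = (visitsPerPeriod π r κ : ℚ) / (period π : ℚ)}

/-- The vectors of positive rational proportions that give to the queues of type `r` the
aggregate proportion `p r / ‖p‖`. -/
def proportions {R : ℕ} (k : ℕ) (p : Fin R → ℕ) : Set (Fin R → Fin k → ℚ) :=
  {q | (∀ r κ, 0 < q r κ) ∧ ∀ r, ∑ κ, q r κ = (p r : ℚ) / (l1norm p : ℚ)}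

/-- All the periodic policies that send to the queues of type `r` the aggregate
proportion `p r / ‖p‖`. -/
def pPolicies {R : ℕ} (k : ℕ) (p : Fin R → ℕ) : Set (Policy R k) :=
  ⋃ q ∈ proportions k p, qPolicies q

/-- The `j`-th (from `j = 0`) job that is sent to a queue of type `r`. -/
def typeJob {R k : ℕ} (π : Policy R k) (r : Fin R) (j : ℕ) : ℕ :=
  Nat.nth (fun n => (π n).1 = r) j

/-- The class `C_p^{(k)}`: the sequence of the types has period `‖p‖`, with `p r` jobs sent to
type `r` per period, and the queues of each type are visited in cyclic order starting from the
first one. -/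
def cyclicPolicies {R : ℕ} (k : ℕ) (p : Fin R → ℕ) : Set (Policy R k) :=
  {π | π ∈ pPolicies k p ∧
    (∀ n, (π (n + l1norm p)).1 = (π n).1) ∧
    (∀ r, Nat.count (fun n => (π n).1 = r) (l1norm p) = p r) ∧
    ∀ r, ((π (typeJob π r 0)).2 : ℕ) = 0 ∧
      ∀ j, ((π (typeJob π r (j + 1))).2 : ℕ) =
        if ((π (typeJob π r j)).2 : ℕ) + 1 < k then ((π (typeJob π r j)).2 : ℕ) + 1 else 0}

/-! ### Waiting times -/

/-- The backward partial sums `∑_{m=0}^n (S_{-m} - T_{-m})`. -/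
def loynesSum {Ω : Type*} (S T : ℤ → Ω → ℝ) (n : ℕ) (ω : Ω) : ℝ :=
  ∑ m ∈ Finset.range (n + 1), (S (-(m : ℤ)) ω - T (-(m : ℤ)) ω)

/-- The stationary waiting time `(sup_{n ≥ 0} ∑_{m=0}^n (S_{-m} - T_{-m}))⁺` of a queue with
(two-sided stationary) service times `S` and inter-arrival times `T`. -/
def stationaryWait {Ω : Type*} (S T : ℤ → Ω → ℝ) (ω : Ω) : ℝ :=
  max (⨆ n : ℕ, loynesSum S T n ω) 0

/-- The random variables that drive the system with `k` queues of each of the `R` types: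
the inter-arrival times at the dispatcher, the service times of the successive jobs of each queue,
the variable that randomizes the phase of the arrival process of each queue, and the
index `V` of the first job that is served. -/
structure Drivers (R k : ℕ) (Ω : Type*) where
  arrival : ℤ → Ω → ℝ
  service : ℤ → Fin R → Fin k → Ω → ℝ
  phase : Fin R → Fin k → Ω → ℝ
  start : Ω → ℕ

/-- The real-valued drivers as a single family. -/
def Drivers.family {R k : ℕ} {Ω : Type*} (D : Drivers R k Ω) :
    ℤ ⊕ (ℤ × Fin R × Fin k) ⊕ (Fin R × Fin k) → Ω → ℝ :=
  Sum.elim D.arrival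
    (Sum.elim (fun i => D.service i.1 i.2.1 i.2.2) (fun i => D.phase i.1 i.2))

/-- The probabilistic assumptions on the drivers: all of them are independent, the inter-arrival
times at the dispatcher have law `τ`, the service times at the queues of type `r` have
law `ν r`, the phases are uniform on `[0, 1]`, and `V` is uniform on `{1, …, N}`. -/
structure Drivers.IsSystem {R k : ℕ} {Ω : Type*} [MeasurableSpace Ω] (D : Drivers R k Ω)
    (P : Measure Ω) (τ : Measure ℝ) (ν : Fin R → Measure ℝ) (N : ℕ) : Prop where
  measurable_family : ∀ i, Measurable (D.family i)
  measurable_start : Measurable D.start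
  indep_family : iIndepFun D.family P
  indep_start : IndepFun (fun ω i => D.family i ω) D.start P
  law_arrival : ∀ n, P.map (D.arrival n) = τ
  law_service : ∀ n r κ, P.map (D.service n r κ) = ν r
  law_phase : ∀ r κ, P.map (D.phase r κ) = volume.restrict (Set.Icc 0 1)
  law_start : ∀ i ∈ Finset.Icc 1 N, P (D.start ⁻¹' {i}) = (N : ENNReal)⁻¹

/-- The index, in the two-sided periodic extension of the policy `π`, of the `j`-th job that is
sent to queue `(r, κ)`. For `0 ≤ j` this is the `j`-th (from `j = 0`) job sent
to `(r, κ)` by `π`. -/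
def visit {R k : ℕ} (π : Policy R k) (r : Fin R) (κ : Fin k) (j : ℤ) : ℤ :=
  (Nat.nth (fun n => π n = (r, κ)) (j % (visitsPerPeriod π r κ : ℤ)).toNat : ℤ) +
    (period π : ℤ) * (j / (visitsPerPeriod π r κ : ℤ))

/-- The time that elapses between the arrivals of the `j`-th and of the `(j+1)`-th job sent to
queue `(r, κ)`: a sum of inter-arrival times at the dispatcher. -/
def patternTime {R k : ℕ} {Ω : Type*} (D : Drivers R k Ω) (π : Policy R k)
    (r : Fin R) (κ : Fin k) (j : ℤ) (ω : Ω) : ℝ :=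
  ∑ i ∈ Finset.Ico (visit π r κ j) (visit π r κ (j + 1)), D.arrival i ω

/-- The stationary two-sided sequence of the inter-arrival times at queue `(r, κ)`. The time with
index `1` is the pattern time with index `j` when the phase lies in `[j / d, (j + 1) / d)`,
for `j = 0, …, d - 1`, where `d` is the number of visits per period; the next times follow
the pattern. -/
def queueArrival {R k : ℕ} {Ω : Type*} (D : Drivers R k Ω) (π : Policy R k)
    (r : Fin R) (κ : Fin k) (n : ℤ) (ω : Ω) : ℝ :=
  patternTime D π r κ (⌊(visitsPerPeriod π r κ : ℝ) * D.phase r κ ω⌋ + (n - 1)) ω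

/-- The stationary waiting time at queue `(r, κ)` under the policy `π`. -/
def queueWait {R k : ℕ} {Ω : Type*} (D : Drivers R k Ω) (π : Policy R k)
    (r : Fin R) (κ : Fin k) : Ω → ℝ :=
  stationaryWait (fun n => D.service n r κ) (queueArrival D π r κ)

/-- `Q` is a partition of `{1, …, n*}` in which the part `Q r κ` has `n* q_{r,κ}` elements. -/
def IsVisitPartition {R k : ℕ} (π : Policy R k) (Q : Fin R → Fin k → Finset ℕ) : Prop :=
  (∀ r κ r' κ', (r, κ) ≠ (r', κ') → Disjoint (Q r κ) (Q r' κ')) ∧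
    (∀ i, (∃ r κ, i ∈ Q r κ) ↔ i ∈ Finset.Icc 1 (period π)) ∧
    ∀ r κ, (Q r κ).card = visitsPerPeriod π r κ

/-- The stationary waiting time `W^{(k)}(π) = ∑_{r,κ} 1{V ∈ Q_{r,κ}} W_{r,κ}^{(k)}(π)` of the
jobs under the policy `π`. -/
def systemWait {R k : ℕ} {Ω : Type*} (D : Drivers R k Ω) (π : Policy R k)
    (Q : Fin R → Fin k → Finset ℕ) (ω : Ω) : ℝ :=
  ∑ r, ∑ κ, if D.start ω ∈ Q r κ then queueWait D π r κ ω else 0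

/-! ### The limit -/

/-- The random variables that drive the limit: the service times of `R` queues, and the
variable that selects one of the queues. -/
structure LimitDrivers (R : ℕ) (Ω : Type*) where
  service : ℤ → Fin R → Ω → ℝ
  select : Ω → Fin R

/-- The probabilistic assumptions on the limit drivers: all of them are independent, the service
times of queue `r` have law `ν r`, and queue `r` is selected with
probability `p r / ‖p‖`. -/
structure LimitDrivers.IsSystem {R : ℕ} {Ω : Type*} [MeasurableSpace Ω] (L : LimitDrivers R Ω)
    (P : Measure Ω) (ν : Fin R → Measure ℝ) (p : Fin R → ℕ) : Prop where
  measurable_service : ∀ n r, Measurable (L.service n r)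
  measurable_select : Measurable L.select
  indep_service : iIndepFun (fun i : ℤ × Fin R => L.service i.1 i.2) P
  indep_select : IndepFun (fun ω (i : ℤ × Fin R) => L.service i.1 i.2 ω) L.select P
  law_service : ∀ n r, P.map (L.service n r) = ν r
  law_select : ∀ r, P (L.select ⁻¹' {r}) = ENNReal.ofReal ((p r : ℝ) / (l1norm p : ℝ))

/-- The constant inter-arrival times `‖p‖ / (p r λ)`. -/
def detArrival {R : ℕ} (Ω : Type*) (lam : ℝ) (p : Fin R → ℕ) (r : Fin R) : ℤ → Ω → ℝ :=
  fun _ _ => (l1norm p : ℝ) / ((p r : ℝ) * lam)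

/-- The stationary waiting time `W_r(p)` of the D/GI/1 queue with inter-arrival
times `‖p‖ / (p r λ)`. -/
def limitQueueWait {R : ℕ} {Ω : Type*} (L : LimitDrivers R Ω) (lam : ℝ) (p : Fin R → ℕ)
    (r : Fin R) : Ω → ℝ :=
  stationaryWait (fun n => L.service n r) (detArrival Ω lam p r)

/-- The mixture `W(p)` of the stationary waiting times of the D/GI/1 queues. -/
def limitWait {R : ℕ} {Ω : Type*} (L : LimitDrivers R Ω) (lam : ℝ) (p : Fin R → ℕ)
    (ω : Ω) : ℝ :=
  ∑ r, if L.select ω = r then limitQueueWait L lam p r ω else 0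

end

end ParallelQueues

/-! Each queue is coupled with a D/GI/1 queue that has the same service times and the constant
inter-arrival time `c = ‖p‖ / (p_r λ)`; it then suffices that the two waiting times are close in
probability, uniformly in `κ`.

Cyclic routing makes `n` consecutive visits to a queue span `k n` jobs of type `r`, hence `k n ‖p‖ /
p_r` jobs at the dispatcher up to an error `‖p‖` that depends on neither `k` nor `n`
(`abs_visit_sub_le`). So the arrival epoch `n + 1` steps back has mean within `‖p‖ / (λ k)` of `(n +
1) c` and variance at most `(n + 1) 2‖p‖ k Var T`. Its mean square distance to `(n + 1) c` is at
most `(n + 1) t_k`, where `t_k → 0` because `Var T = o(1/k)`.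

To compare the suprema (`measure_wait_sub_wait_le`), take `E S < c' < c'' < c`. By the strong law
the service sums stay below slope `c'` after some `M`, outside an event whose small probability does
not depend on `k` or `κ`. The first `M` epochs are controlled by Chebyshev. Later epochs need only a
lower bound of slope `c'`: Chebyshev along the squares gives summable bounds with slope `c''`, and
monotonicity fills the gaps. Off the bad events both walks are nonpositive after `M` and differ by
at most `ε` before it, so the waiting times differ by at most `ε`.

The coupled D/GI/1 waiting time has the law of `W_r(p)`. The weights of the queues of type `r` sum
to `p_r / ‖p‖`, so bounds uniform in `κ` pass to the mixture. Almost sure finiteness, for each fixed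
`k`, is the strong law applied to services and arrivals. -/

namespace ParallelQueues

/-! ### Enumeration of a periodic set of integers -/

section Periodic

variable {A : ℕ → Prop} [DecidablePred A] {N : ℕ}

lemma infinite_of_periodic (hA : ∀ n, A (n + N) ↔ A n) (hd : 0 < Nat.count A N) :
    (Set.ofPred A).Infinite := by
  have hN : 0 < N := by
    rcases Nat.eq_zero_or_pos N with h | h
    · subst h; simp at hd
    · exact h
  obtain ⟨n, hn, hAn⟩ : ∃ n < N, A n := by
    by_contra! h
    have : Nat.count A N = 0 := by
      rw [Nat.count_eq_card_filter_range, Finset.card_eq_zero, Finset.filter_eq_empty_iff]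
      intro x hx
      exact h x (Finset.mem_range.1 hx)
    omega
  have hmul : ∀ m, A (n + N * m) := by
    intro m
    induction m with
    | zero => simpa using hAn
    | succ m ih => rw [Nat.mul_succ, ← add_assoc, hA]; exact ih
  refine Set.infinite_of_forall_exists_gt fun a => ⟨n + N * (a + 1), hmul _, ?_⟩
  nlinarith

lemma nth_add_count (hA : ∀ n, A (n + N) ↔ A n) (hd : 0 < Nat.count A N) (s : ℕ) :
    Nat.nth A (s + Nat.count A N) = Nat.nth A s + N := by
  have hinf := infinite_of_periodic hA hd
  have hmem : A (Nat.nth A s + N) := (hA _).2 (Nat.nth_mem_of_infinite hinf s)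
  have hcount : Nat.count A (Nat.nth A s + N) = s + Nat.count A N := by
    rw [add_comm, Nat.count_add, add_comm s]
    congr 1
    have h : (fun k => A (N + k)) = A := by
      funext k
      rw [add_comm]
      exact propext (hA k)
    simp only [h]
    exact Nat.count_nth_of_infinite hinf s
  rw [← hcount, Nat.nth_count hmem]

lemma nth_add_count_mul (hA : ∀ n, A (n + N) ↔ A n) (hd : 0 < Nat.count A N) (s q : ℕ) :
    Nat.nth A (s + Nat.count A N * q) = Nat.nth A s + N * q := by
  induction q with
  | zero => simp
  | succ q ih => rw [Nat.mul_succ, ← add_assoc, nth_add_count hA hd, ih]; ring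

/-- Whole periods shift the enumeration exactly. Sandwiching `m` between consecutive multiples of
the number of elements per period leaves an error of at most one period. -/
lemma nth_add_sub_bounds (hA : ∀ n, A (n + N) ↔ A n) (hd : 0 < Nat.count A N) (i m : ℕ) :
    |((Nat.nth A (i + m) : ℝ) - Nat.nth A i) - (m : ℝ) * N / Nat.count A N| ≤ N := by
  have hinf := infinite_of_periodic hA hd
  set d := Nat.count A N with hdef
  have hlow : Nat.nth A i + N * (m / d) ≤ Nat.nth A (i + m) := by
    rw [← nth_add_count_mul hA hd]
    exact Nat.nth_monotone hinf (by rw [← hdef]; have := Nat.mul_div_le m d; omega)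
  have hup : Nat.nth A (i + m) ≤ Nat.nth A i + N * (m / d + 1) := by
    rw [← nth_add_count_mul hA hd]
    exact Nat.nth_monotone hinf (by rw [← hdef]; have := Nat.lt_mul_div_succ m hd; omega)
  have hd' : (0 : ℝ) < d := by exact_mod_cast hd
  have hN : (0 : ℝ) ≤ N := Nat.cast_nonneg _
  have h1 : ((m / d : ℕ) : ℝ) ≤ (m : ℝ) / d := Nat.cast_div_le
  have h2 : (m : ℝ) / d ≤ ((m / d : ℕ) : ℝ) + 1 := by
    rw [div_le_iff₀ hd']
    have := (Nat.lt_mul_div_succ m hd).le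
    calc (m : ℝ) ≤ ((d * (m / d + 1) : ℕ) : ℝ) := by exact_mod_cast this
      _ = _ := by push_cast; ring
  have e : (m : ℝ) * N / d = N * ((m : ℝ) / d) := by ring
  have hlow' : (Nat.nth A i : ℝ) + N * ((m / d : ℕ) : ℝ) ≤ Nat.nth A (i + m) := by
    exact_mod_cast hlow
  have hup' : (Nat.nth A (i + m) : ℝ) ≤ Nat.nth A i + N * (((m / d : ℕ) : ℝ) + 1) := by
    exact_mod_cast hup
  have h3 := mul_le_mul_of_nonneg_left h1 hN
  have h4 := mul_le_mul_of_nonneg_left h2 hN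
  rw [e, abs_le]
  constructor <;> linarith

end Periodic

/-! ### Visit times of cyclic policies -/

section Policies

variable {R k : ℕ} {p : Fin R → ℕ} {π : Policy R k}

lemma period_spec (hπ : π ∈ pPolicies k p) : 0 < period π ∧ ∀ n, π (n + period π) = π n := by
  simp only [pPolicies, Set.mem_iUnion] at hπ
  obtain ⟨q, -, hq⟩ := hπ
  exact Nat.sInf_mem (s := {N : ℕ | 0 < N ∧ ∀ n, π (n + N) = π n}) hq.1

lemma visitsPerPeriod_pos (hπ : π ∈ pPolicies k p) (r : Fin R) (κ : Fin k) :
    0 < visitsPerPeriod π r κ := by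
  simp only [pPolicies, Set.mem_iUnion] at hπ
  obtain ⟨q, hq, hqπ⟩ := hπ
  have h := hq.1 r κ
  rw [hqπ.2 r κ] at h
  by_contra h0
  simp [Nat.eq_zero_of_not_pos h0] at h

lemma sum_visitsPerPeriod (hπ : π ∈ pPolicies k p) (r : Fin R) :
    ∑ κ, (visitsPerPeriod π r κ : ℝ) / (period π : ℝ) = (p r : ℝ) / (l1norm p : ℝ) := by
  simp only [pPolicies, Set.mem_iUnion] at hπ
  obtain ⟨q, hq, hqπ⟩ := hπ
  have h := hq.2 r
  simp only [hqπ.2] at h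
  have h' := congrArg (Rat.cast : ℚ → ℝ) h
  push_cast at h'
  exact h'

lemma periodic_visit (hπ : π ∈ pPolicies k p) (r : Fin R) (κ : Fin k) (n : ℕ) :
    π (n + period π) = (r, κ) ↔ π n = (r, κ) := by
  rw [(period_spec hπ).2]

lemma visit_natCast (hπ : π ∈ pPolicies k p) (r : Fin R) (κ : Fin k) (j : ℕ) :
    visit π r κ j = Nat.nth (fun n => π n = (r, κ)) j := by
  have h := nth_add_count_mul (periodic_visit hπ r κ) (visitsPerPeriod_pos hπ r κ)
    (j % visitsPerPeriod π r κ) (j / visitsPerPeriod π r κ)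
  have e : j % visitsPerPeriod π r κ + Nat.count (fun n => π n = (r, κ)) (period π) *
      (j / visitsPerPeriod π r κ) = j := Nat.mod_add_div _ _
  rw [e] at h
  rw [h, visit]
  norm_cast

lemma visit_add_mul (hπ : π ∈ pPolicies k p) (r : Fin R) (κ : Fin k) (j q : ℤ) :
    visit π r κ (j + visitsPerPeriod π r κ * q) = visit π r κ j + period π * q := by
  have hd : (visitsPerPeriod π r κ : ℤ) ≠ 0 := by
    exact_mod_cast (visitsPerPeriod_pos hπ r κ).ne'
  rw [visit, visit, Int.add_mul_emod_self_left, Int.add_mul_ediv_left _ _ hd]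
  ring

/-- A shift by whole periods brings any starting index of the two-sided extension into the
nonnegative range, so gaps between visits can be computed with `Nat.nth`. -/
lemma visit_eq_nth_sub (hπ : π ∈ pPolicies k p) (r : Fin R) (κ : Fin k) (j : ℤ) :
    ∃ (i : ℕ) (a : ℤ), ∀ n : ℕ,
      visit π r κ (j + n) = Nat.nth (fun n => π n = (r, κ)) (i + n) + a := by
  have hd : (0 : ℤ) < (visitsPerPeriod π r κ : ℤ) := by
    exact_mod_cast visitsPerPeriod_pos hπ r κ
  have h0 := Int.emod_nonneg j hd.ne'
  refine ⟨(j % (visitsPerPeriod π r κ : ℤ)).toNat,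
    period π * (j / (visitsPerPeriod π r κ : ℤ)), fun n => ?_⟩
  rw [← visit_natCast hπ, ← visit_add_mul hπ]
  congr 1
  push_cast
  rw [Int.toNat_of_nonneg h0]
  have := Int.emod_add_mul_ediv j (visitsPerPeriod π r κ : ℤ)
  linarith

lemma infinite_visit (hπ : π ∈ pPolicies k p) (r : Fin R) (κ : Fin k) :
    (Set.ofPred fun n => π n = (r, κ)).Infinite :=
  infinite_of_periodic (periodic_visit hπ r κ) (visitsPerPeriod_pos hπ r κ)

lemma visit_mono (hπ : π ∈ pPolicies k p) (r : Fin R) (κ : Fin k) :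
    Monotone (visit π r κ) := by
  refine monotone_int_of_le_succ fun j => ?_
  obtain ⟨i, a, h⟩ := visit_eq_nth_sub hπ r κ j
  have h0 := h 0
  have h1 := h 1
  simp only [Nat.cast_zero, add_zero, Nat.cast_one] at h0 h1
  rw [h0, h1]
  have := Nat.nth_monotone (infinite_visit hπ r κ) (Nat.le_succ i)
  gcongr

lemma typeJob_snd (hπ : π ∈ cyclicPolicies k p) (r : Fin R) (j : ℕ) :
    ((π (typeJob π r j)).2 : ℕ) = j % k := by
  induction j with
  | zero => simpa using (hπ.2.2.2 r).1
  | succ j ih =>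
    have hk : 0 < k := (π 0).2.pos
    have hlt := Nat.mod_lt j hk
    rw [(hπ.2.2.2 r).2 j, ih]
    split_ifs with h
    · rw [Nat.add_mod, Nat.mod_eq_of_lt (a := 1) (by omega), Nat.mod_eq_of_lt h]
    · have : j % k + 1 = k := by omega
      rw [← Nat.mod_add_mod, this, Nat.mod_self]

lemma periodic_type (hπ : π ∈ cyclicPolicies k p) (r : Fin R) (n : ℕ) :
    (π (n + l1norm p)).1 = r ↔ (π n).1 = r := by
  rw [hπ.2.1]

/-- Both sides are strictly increasing in `j` with the same range, the jobs of type `r` whose rank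
is congruent to `κ` modulo `k`; such enumerations coincide. -/
lemma nth_visit_eq_typeJob (hπ : π ∈ cyclicPolicies k p) (r : Fin R) (hp : 0 < p r) (κ : Fin k)
    (j : ℕ) : Nat.nth (fun n => π n = (r, κ)) j = typeJob π r (κ + k * j) := by
  have hcount := hπ.2.2.1 r
  have hinf : (Set.ofPred fun n => (π n).1 = r).Infinite :=
    infinite_of_periodic (periodic_type hπ r) (by rw [hcount]; exact hp)
  have hinf' := infinite_visit hπ.1 r κ
  have hk : 0 < k := κ.pos
  have hmono : StrictMono fun j : ℕ => typeJob π r (κ + k * j) := by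
    refine (Nat.nth_strictMono hinf).comp fun a b hab => ?_
    have := Nat.mul_lt_mul_of_pos_left hab hk
    omega
  have hrange : Set.range (Nat.nth fun n => π n = (r, κ)) =
      Set.range fun j : ℕ => typeJob π r (κ + k * j) := by
    rw [Nat.range_nth_of_infinite hinf']
    ext n
    constructor
    · intro hn
      have hn' : π n = (r, κ) := hn
      have e : typeJob π r (Nat.count (fun n => (π n).1 = r) n) = n :=
        Nat.nth_count (p := fun n => (π n).1 = r) (by rw [hn'])
      have h2 := typeJob_snd hπ r (Nat.count (fun n => (π n).1 = r) n)
      rw [e, hn'] at h2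
      refine ⟨Nat.count (fun n => (π n).1 = r) n / k, ?_⟩
      dsimp only at h2 ⊢
      rw [h2, Nat.mod_add_div, e]
    · rintro ⟨j, rfl⟩
      refine Prod.ext (Nat.nth_mem_of_infinite hinf _) (Fin.ext ?_)
      rw [typeJob_snd hπ r]
      simp [Nat.mod_eq_of_lt κ.2]
  exact congrFun (((Nat.nth_strictMono hinf').range_inj hmono).1 hrange) j

/-- In `n` consecutive visits to a queue, the number of jobs that arrive at the dispatcher
is `k n ‖p‖ / p r` up to the error `‖p‖`. -/
lemma abs_visit_sub_le (hπ : π ∈ cyclicPolicies k p) (r : Fin R) (hp : 0 < p r) (κ : Fin k)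
    (j : ℤ) (n : ℕ) :
    |((visit π r κ (j + n) - visit π r κ j : ℤ) : ℝ) - (k * n : ℝ) * l1norm p / p r|
      ≤ l1norm p := by
  have hcount := hπ.2.2.1 r
  obtain ⟨i, a, h⟩ := visit_eq_nth_sub hπ.1 r κ j
  have h0 := h 0
  simp only [Nat.cast_zero, add_zero] at h0
  rw [h n, h0, nth_visit_eq_typeJob hπ r hp, nth_visit_eq_typeJob hπ r hp]
  -- The period used is `‖p‖`, that of the types, rather than the period of the whole policy: this
  -- keeps the error independent of `k`.
  have hb := nth_add_sub_bounds (periodic_type hπ r) (by rw [hcount]; exact hp) (κ + k * i) (k * n)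
  rw [hcount] at hb
  have e : (κ : ℕ) + k * (i + n) = κ + k * i + k * n := by ring
  rw [e]
  push_cast at hb ⊢
  simpa [typeJob] using hb

end Policies

/-! ### Deterministic comparison of suprema -/

section Suprema

lemma bddAbove_range_of_nonpos_of_ge {x : ℕ → ℝ} {M : ℕ} (h : ∀ n ≥ M, x n ≤ 0) :
    BddAbove (Set.range x) :=
  IsBoundedUnder.bddAbove_range ⟨0, eventually_map.2 (eventually_atTop.2 ⟨M, h⟩)⟩

/-- The positive part absorbs every index from `M` on, so only finitely many terms have to be
compared. -/
lemma max_iSup_le_max_iSup_add {x y : ℕ → ℝ} {ε : ℝ} (hε : 0 ≤ ε) {M : ℕ}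
    (h : ∀ n < M, x n ≤ y n + ε) (hx : ∀ n ≥ M, x n ≤ 0) (hy : ∀ n ≥ M, y n ≤ 0) :
    max (⨆ n, x n) 0 ≤ max (⨆ n, y n) 0 + ε := by
  -- A real `⨆` takes the default value `0` on unbounded families, so `le_ciSup` needs this.
  have hb := bddAbove_range_of_nonpos_of_ge hy
  have h0 : 0 ≤ max (⨆ n, y n) 0 + ε := add_nonneg (le_max_right _ _) hε
  refine max_le (ciSup_le fun n => ?_) h0
  rcases lt_or_ge n M with hn | hn
  · have h1 := le_ciSup hb n
    have h2 := le_max_left (⨆ n, y n) 0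
    linarith [h n hn]
  · exact (hx n hn).trans h0

lemma abs_max_iSup_sub_max_iSup_le {x y : ℕ → ℝ} {ε : ℝ} (hε : 0 ≤ ε) {M : ℕ}
    (h : ∀ n < M, |x n - y n| ≤ ε) (hx : ∀ n ≥ M, x n ≤ 0) (hy : ∀ n ≥ M, y n ≤ 0) :
    |max (⨆ n, x n) 0 - max (⨆ n, y n) 0| ≤ ε := by
  have h1 := max_iSup_le_max_iSup_add hε (x := x) (y := y)
    (fun n hn => by linarith [(abs_le.1 (h n hn)).2]) hx hy
  have h2 := max_iSup_le_max_iSup_add hε (x := y) (y := x)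
    (fun n hn => by linarith [(abs_le.1 (h n hn)).1]) hy hx
  rw [abs_le]
  constructor <;> linarith

lemma bddAbove_range_of_tendsto_div {x : ℕ → ℝ} {l : ℝ} (hl : l < 0)
    (h : Tendsto (fun n : ℕ => x n / ((n : ℝ) + 1)) atTop (𝓝 l)) : BddAbove (Set.range x) := by
  obtain ⟨M, hM⟩ := eventually_atTop.1 (h.eventually (gt_mem_nhds hl))
  refine bddAbove_range_of_nonpos_of_ge (M := M) fun n hn => ?_
  have hpos : (0 : ℝ) < (n : ℝ) + 1 := by positivity
  have := hM n hn
  rw [div_lt_iff₀ hpos] at this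
  linarith

end Suprema

/-! ### Linear growth read off along the squares -/

section Squares

lemma exists_sq_ratio {c' c'' : ℝ} (hc' : 0 < c') (h : c' < c'') :
    ∃ m₀ : ℕ, 0 < m₀ ∧ ∀ m ≥ m₀, ((m : ℝ) + 1) ^ 2 * c' ≤ (m : ℝ) ^ 2 * c'' := by
  -- For `m ≥ 1`, `(m + 1)² ≤ m² + 3m`, so it suffices that `3 c' ≤ m (c'' - c')`.
  obtain ⟨m₀, hm₀⟩ := exists_nat_ge (3 * c' / (c'' - c'))
  refine ⟨m₀ + 1, by omega, fun m hm => ?_⟩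
  have hm1 : (m₀ : ℝ) + 1 ≤ m := by exact_mod_cast hm
  have h0 : (0 : ℝ) ≤ m₀ := Nat.cast_nonneg _
  rw [div_le_iff₀ (by linarith)] at hm₀
  have h1 : 3 * c' ≤ m * (c'' - c') := by nlinarith
  have h2 : 3 * c' * m ≤ m * (c'' - c') * m := mul_le_mul_of_nonneg_right h1 (by linarith)
  have h3 : 0 ≤ c' * (m - 1) := mul_nonneg hc'.le (by linarith)
  nlinarith

/-- A monotone sequence that grows linearly along the squares grows linearly. -/
lemma mul_le_of_le_on_squares {c' c'' : ℝ} (hc' : 0 < c') {m₀ : ℕ}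
    (hm₀ : ∀ m ≥ m₀, ((m : ℝ) + 1) ^ 2 * c' ≤ (m : ℝ) ^ 2 * c'') (h0 : 0 < m₀)
    {G : ℕ → ℝ} (hG : Monotone G) (h : ∀ m : ℕ, ((m : ℝ) + 1) ^ 2 * c'' ≤ G ((m + 1) ^ 2 - 1))
    {n : ℕ} (hn : m₀ ^ 2 ≤ n) : ((n : ℝ) + 1) * c' ≤ G n := by
  -- Here `m² ≤ n + 1 < (m + 1)²`: bound `G n` below by its value at index `m² - 1`, and let the gap
  -- between `c'` and `c''` pay for the ratio of consecutive squares.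
  set m := Nat.sqrt (n + 1) with hm
  have hmm : m₀ ≤ m := by rw [hm, Nat.le_sqrt']; omega
  obtain ⟨l, hl⟩ : ∃ l, m = l + 1 := ⟨m - 1, by omega⟩
  have h1 : (m : ℕ) ^ 2 ≤ n + 1 := Nat.sqrt_le' _
  have h2 : n + 1 < (m + 1) ^ 2 := Nat.lt_succ_sqrt' _
  have h2' : ((n : ℝ) + 1) ≤ ((m : ℝ) + 1) ^ 2 := by exact_mod_cast h2.le
  calc ((n : ℝ) + 1) * c' ≤ ((m : ℝ) + 1) ^ 2 * c' := by gcongr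
    _ ≤ (m : ℝ) ^ 2 * c'' := hm₀ m hmm
    _ = ((l : ℝ) + 1) ^ 2 * c'' := by rw [hl]; push_cast; ring
    _ ≤ G ((l + 1) ^ 2 - 1) := h l
    _ ≤ G n := hG (by rw [← hl]; omega)

end Squares

/-! ### Waiting times with perturbed arrival epochs -/

section Comparison

variable {Ω : Type*} [MeasurableSpace Ω] {P : Measure Ω}

/-- If the arrival epochs `G` are close to `(n + 1) c` in the mean square sense, the waiting time
with arrival epochs `G` is close in probability to that with arrival epochs `(n + 1) c`. -/
lemma measure_wait_sub_wait_le {c c' c'' ε t : ℝ} (hc' : 0 < c') (hc'' : c' < c'') (hc : c'' < c)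
    (hε : 0 < ε) (ht : 0 ≤ t) {m₀ M : ℕ} (h0 : 0 < m₀)
    (hm₀ : ∀ m ≥ m₀, ((m : ℝ) + 1) ^ 2 * c' ≤ (m : ℝ) ^ 2 * c'') (hM : m₀ ^ 2 ≤ M)
    {X G : ℕ → Ω → ℝ} (hG : ∀ᵐ ω ∂P, Monotone fun n => G n ω)
    (htail : ∀ (n : ℕ) (a : ℝ), 0 < a →
      P {ω | a ≤ |G n ω - ((n : ℝ) + 1) * c|} ≤ ENNReal.ofReal (((n : ℝ) + 1) * t / a ^ 2)) :
    P {ω | ε < |max (⨆ n, (X n ω - G n ω)) 0 - max (⨆ n, (X n ω - ((n : ℝ) + 1) * c)) 0|} ≤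
      P {ω | ∃ n ≥ M, ((n : ℝ) + 1) * c' < X n ω} +
        ENNReal.ofReal (t * (M * (M / ε ^ 2) +
          (∑' m : ℕ, 1 / ((m : ℝ) + 1) ^ 2) / (c - c'') ^ 2)) := by
  set K : ℝ := ∑' m : ℕ, 1 / ((m : ℝ) + 1) ^ 2
  have hsum : Summable fun m : ℕ => 1 / ((m : ℝ) + 1) ^ 2 := by
    have := (summable_nat_add_iff 1).2 (Real.summable_one_div_nat_pow.2 (by norm_num : 1 < 2))
    exact_mod_cast this
  -- The bad events: `B`, services overtake slope `c'` after `M`; `E n` for `n < M`, an early epoch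
  -- is off by `ε`; `F m`, an epoch at a square index may fall to slope `c''` or below; `Z`, a null
  -- set. Chebyshev at linear distance costs a multiple of `1 / (n + 1)`, which is summable along
  -- the squares but not over all `n`.
  set B : Set Ω := {ω | ∃ n ≥ M, ((n : ℝ) + 1) * c' < X n ω}
  set E : ℕ → Set Ω := fun n => {ω | ε ≤ |G n ω - ((n : ℝ) + 1) * c|}
  set F : ℕ → Set Ω := fun m =>
    {ω | ((m : ℝ) + 1) ^ 2 * (c - c'') ≤
      |G ((m + 1) ^ 2 - 1) ω - ((((m + 1) ^ 2 - 1 : ℕ) : ℝ) + 1) * c|}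
  set Z : Set Ω := {ω | ¬ Monotone fun n => G n ω}
  have hcast : ∀ m : ℕ, (((m + 1) ^ 2 - 1 : ℕ) : ℝ) + 1 = ((m : ℝ) + 1) ^ 2 := by
    intro m
    have h1 : 1 ≤ (m + 1) ^ 2 := Nat.one_le_pow _ _ (by omega)
    rw [Nat.cast_sub h1]
    push_cast
    ring
  have hsub : {ω | ε < |max (⨆ n, (X n ω - G n ω)) 0 -
      max (⨆ n, (X n ω - ((n : ℝ) + 1) * c)) 0|} ⊆
      B ∪ ((⋃ n ∈ Finset.range M, E n) ∪ (⋃ m, F m)) ∪ Z := by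
    intro ω hω
    by_contra hcon
    simp only [Set.mem_union, not_or, Set.mem_iUnion, not_exists, Finset.mem_range] at hcon
    obtain ⟨⟨hB, hE, hF⟩, hZ⟩ := hcon
    have hmono : Monotone fun n => G n ω := by simpa [Z] using hZ
    have hgrid : ∀ m : ℕ, ((m : ℝ) + 1) ^ 2 * c'' ≤ G ((m + 1) ^ 2 - 1) ω := by
      intro m
      have h1 := hF m
      simp only [F, Set.mem_ofPred_eq, not_le, hcast] at h1
      have h2 := (abs_lt.1 h1).1
      linarith
    have hXB : ∀ n ≥ M, X n ω ≤ ((n : ℝ) + 1) * c' := by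
      intro n hn
      by_contra! hlt
      exact hB ⟨n, hn, hlt⟩
    have hω' : ε < _ := hω
    refine absurd hω' (not_lt.2 (abs_max_iSup_sub_max_iSup_le hε.le (M := M) ?_ ?_ ?_))
    · intro n hn
      have h1 := hE n hn
      simp only [E, Set.mem_ofPred_eq, not_le] at h1
      rw [abs_sub_comm] at h1
      have e : X n ω - G n ω - (X n ω - ((n : ℝ) + 1) * c) = ((n : ℝ) + 1) * c - G n ω := by ring
      rw [e]
      exact h1.le
    · intro n hn
      have h1 := mul_le_of_le_on_squares hc' hm₀ h0 hmono hgrid (hM.trans hn)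
      have h2 := hXB n hn
      linarith
    · intro n hn
      have h2 := hXB n hn
      have h3 : ((n : ℝ) + 1) * c' ≤ ((n : ℝ) + 1) * c := by
        have : c' ≤ c := by linarith
        gcongr
      linarith
  have hE : P (⋃ n ∈ Finset.range M, E n) ≤ ENNReal.ofReal (t * (M * (M / ε ^ 2))) := by
    calc P (⋃ n ∈ Finset.range M, E n) ≤ ∑ n ∈ Finset.range M, P (E n) :=
          measure_biUnion_finset_le _ _
      _ ≤ ∑ n ∈ Finset.range M, ENNReal.ofReal (M * t / ε ^ 2) := by
          refine Finset.sum_le_sum fun n hn => (htail n ε hε).trans (ENNReal.ofReal_le_ofReal ?_)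
          have : (n : ℝ) + 1 ≤ M := by exact_mod_cast Finset.mem_range.1 hn
          gcongr
      _ = ENNReal.ofReal (t * (M * (M / ε ^ 2))) := by
          rw [Finset.sum_const, Finset.card_range, nsmul_eq_mul, ← ENNReal.ofReal_natCast,
            ← ENNReal.ofReal_mul (Nat.cast_nonneg _)]
          congr 1
          ring
  have hF : P (⋃ m, F m) ≤ ENNReal.ofReal (t * (K / (c - c'') ^ 2)) := by
    have hpos : 0 < c - c'' := by linarith
    calc P (⋃ m, F m) ≤ ∑' m, P (F m) := measure_iUnion_le _
      _ ≤ ∑' m : ℕ, ENNReal.ofReal (t / (c - c'') ^ 2 * (1 / ((m : ℝ) + 1) ^ 2)) := by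
          refine ENNReal.tsum_le_tsum fun m => (htail _ _ (by positivity)).trans_eq ?_
          rw [hcast]
          congr 1
          field_simp
      _ = ENNReal.ofReal (t * (K / (c - c'') ^ 2)) := by
          rw [← ENNReal.ofReal_tsum_of_nonneg (fun m => by positivity) (hsum.mul_left _),
            tsum_mul_left]
          congr 1
          ring
  have hZ : P Z = 0 := by simpa [Z, ae_iff] using hG
  have hK : 0 ≤ K := tsum_nonneg fun m => by positivity
  calc _ ≤ P (B ∪ ((⋃ n ∈ Finset.range M, E n) ∪ (⋃ m, F m)) ∪ Z) := measure_mono hsub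
    _ ≤ P B + (P (⋃ n ∈ Finset.range M, E n) + P (⋃ m, F m)) + P Z :=
        (measure_union_le _ _).trans (by
          gcongr
          refine (measure_union_le _ _).trans ?_
          gcongr
          exact measure_union_le _ _)
    _ ≤ P B + (ENNReal.ofReal (t * (M * (M / ε ^ 2))) +
          ENNReal.ofReal (t * (K / (c - c'') ^ 2))) + 0 := by rw [hZ]; gcongr
    _ = _ := by
        rw [add_zero, ← ENNReal.ofReal_add (by positivity) (by positivity), ← mul_add]

end Comparison

/-! ### Probabilistic tools: random indices, second moments, the strong law -/

section RandomIndex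

variable {Ω : Type*} [MeasurableSpace Ω] {P : Measure Ω} [IsProbabilityMeasure P]

/-- A bound that holds for each value of an independent random index holds at the random index. -/
lemma measure_random_index_le {J : Ω → ℤ} (hJ : Measurable J) {E : ℤ → Set Ω} {b : ENNReal}
    (hE : ∀ j, P (E j) ≤ b) (hind : ∀ j, P (E j ∩ J ⁻¹' {j}) = P (E j) * P (J ⁻¹' {j})) :
    P {ω | ω ∈ E (J ω)} ≤ b := by
  have hsub : {ω | ω ∈ E (J ω)} ⊆ ⋃ j, E j ∩ J ⁻¹' {j} := fun ω hω =>
    Set.mem_iUnion.2 ⟨J ω, hω, rfl⟩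
  calc P {ω | ω ∈ E (J ω)} ≤ ∑' j, P (E j ∩ J ⁻¹' {j}) :=
        (measure_mono hsub).trans (measure_iUnion_le _)
    _ ≤ ∑' j, b * P (J ⁻¹' {j}) := by
        refine ENNReal.tsum_le_tsum fun j => ?_
        rw [hind]
        gcongr
        exact hE j
    _ = b * P (⋃ j, J ⁻¹' {j}) := by
        rw [ENNReal.tsum_mul_left, measure_iUnion]
        · exact fun i j hij => Disjoint.preimage _ (by simpa using hij)
        · exact fun j => hJ (measurableSet_singleton j)
    _ ≤ b * 1 := by gcongr; exact prob_le_one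
    _ = b := mul_one b

end RandomIndex

section SecondMoment

variable {Ω : Type*} [MeasurableSpace Ω] {P : Measure Ω} [IsProbabilityMeasure P]

/-- Markov's inequality for `(Y - b)²`, whose mean is variance plus squared bias. Centring at `b`
instead of the mean matters because the arrival epochs are slightly biased. -/
lemma measure_ge_abs_sub_le {Y : Ω → ℝ} (hY : MemLp Y 2 P) (b : ℝ) {a : ℝ} (ha : 0 < a) :
    P {ω | a ≤ |Y ω - b|} ≤ ENNReal.ofReal ((variance Y P + (∫ ω, Y ω ∂P - b) ^ 2) / a ^ 2) := by
  have hYb : MemLp (fun ω => Y ω - b) 2 P := hY.sub (memLp_const b)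
  have hvar := variance_eq_sub hYb
  rw [variance_sub_const hY.aestronglyMeasurable,
    integral_sub (hY.integrable (by norm_num)) (integrable_const b), integral_const] at hvar
  simp only [probReal_univ, smul_eq_mul, one_mul, Pi.pow_apply] at hvar
  have hmarkov := mul_meas_ge_le_integral_of_nonneg (μ := P) (f := fun ω => (Y ω - b) ^ 2)
    (ae_of_all _ fun ω => sq_nonneg _) hYb.integrable_sq (a ^ 2)
  have hset : {ω | a ≤ |Y ω - b|} = {ω | a ^ 2 ≤ (Y ω - b) ^ 2} := by
    ext ω
    simp only [Set.mem_ofPred_eq]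
    rw [sq_le_sq, abs_of_pos ha]
  rw [hset, ← ofReal_measureReal]
  refine ENNReal.ofReal_le_ofReal ?_
  rw [le_div_iff₀ (by positivity)]
  linarith

end SecondMoment

section IcoSums

lemma sum_Ico_add_sum_Ico {f : ℤ → ℝ} {a b c : ℤ} (hab : a ≤ b) (hbc : b ≤ c) :
    ∑ i ∈ Finset.Ico a b, f i + ∑ i ∈ Finset.Ico b c, f i = ∑ i ∈ Finset.Ico a c, f i := by
  rw [← Finset.sum_union (Finset.Ico_disjoint_Ico_consecutive a b c),
    Finset.Ico_union_Ico_eq_Ico hab hbc]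

lemma sum_Ico_eq_sum_range_sub {f : ℤ → ℝ} (a : ℤ) (n : ℕ) :
    ∑ i ∈ Finset.Ico (a - n) a, f i = ∑ m ∈ Finset.range n, f (a - 1 - m) := by
  induction n with
  | zero => simp
  | succ n ih =>
    rw [Finset.sum_range_succ, ← ih, ← sum_Ico_add_sum_Ico (a := a - (n + 1 : ℕ)) (b := a - n)
      (c := a) (by push_cast; linarith) (by linarith [Int.natCast_nonneg n]), add_comm]
    congr 1
    have e : Finset.Ico (a - ((n + 1 : ℕ) : ℤ)) (a - n) = {a - 1 - n} := by
      ext x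
      simp only [Finset.mem_Ico, Finset.mem_singleton]
      push_cast
      omega
    rw [e, Finset.sum_singleton]

end IcoSums

section Laws

variable {Ω : Type*} [MeasurableSpace Ω] {P : Measure Ω}

lemma identDistrib_id_of_map_eq {X : Ω → ℝ} {m : Measure ℝ} (hX : Measurable X)
    (h : P.map X = m) : IdentDistrib X (fun x : ℝ => x) P m :=
  ⟨hX.aemeasurable, aemeasurable_id, by rw [h]; exact Measure.map_id.symm⟩

/-- The strong law of large numbers for an i.i.d. sequence with a given law. -/
lemma tendsto_sum_range_div {X : ℕ → Ω → ℝ} {m : Measure ℝ} (hX : ∀ n, Measurable (X n))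
    (hlaw : ∀ n, P.map (X n) = m) (hind : iIndepFun X P) (hint : Integrable (fun x : ℝ => x) m) :
    ∀ᵐ ω ∂P, Tendsto (fun n : ℕ => (∑ i ∈ Finset.range n, X i ω) / n) atTop
      (𝓝 (∫ x, x ∂m)) := by
  have hid := fun n => identDistrib_id_of_map_eq (hX n) (hlaw n)
  rw [← (hid 0).integral_eq]
  exact strong_law_ae_real X ((hid 0).integrable_iff.2 hint) (fun i j hij => hind.indepFun hij)
    fun i => (hid i).trans (hid 0).symm

end Laws

/-! ### Arrival epochs at one queue -/

section Drivers

variable {R k : ℕ} {p : Fin R → ℕ} {π : Policy R k} {Ω : Type*} {D : Drivers R k Ω}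

/-- The sum of the `n` inter-arrival times at queue `(r, κ)` that precede the visit `j`. -/
noncomputable def backwardSum (D : Drivers R k Ω) (π : Policy R k) (r : Fin R) (κ : Fin k)
    (j : ℤ) (n : ℕ) (ω : Ω) : ℝ :=
  ∑ i ∈ Finset.Ico (visit π r κ (j - n)) (visit π r κ j), D.arrival i ω

/-- The index of the pattern time that follows the inter-arrival time with index `0`. -/
noncomputable def phaseIndex (D : Drivers R k Ω) (π : Policy R k) (r : Fin R) (κ : Fin k)
    (ω : Ω) : ℤ :=
  ⌊(visitsPerPeriod π r κ : ℝ) * D.phase r κ ω⌋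

/-- Consecutive intervals between visits are glued together. The offset `-1` comes from the
convention that the inter-arrival time with index `0` ends at the visit selected by the phase. -/
lemma sum_patternTime (hπ : π ∈ pPolicies k p) (r : Fin R) (κ : Fin k) (j : ℤ) (n : ℕ) (ω : Ω) :
    ∑ m ∈ Finset.range n, patternTime D π r κ (j + (-(m : ℤ) - 1)) ω =
      backwardSum D π r κ j n ω := by
  induction n with
  | zero => simp [backwardSum]
  | succ n ih =>
    rw [Finset.sum_range_succ, ih, backwardSum, backwardSum, patternTime, add_comm]
    have e1 : j + (-(n : ℤ) - 1) = j - ((n + 1 : ℕ) : ℤ) := by push_cast; ring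
    have e2 : j - ((n + 1 : ℕ) : ℤ) + 1 = j - n := by push_cast; ring
    rw [e1, e2]
    refine sum_Ico_add_sum_Ico (visit_mono hπ r κ ?_) (visit_mono hπ r κ ?_)
    · push_cast; linarith
    · linarith [Int.natCast_nonneg n]

lemma loynesSum_queueArrival (hπ : π ∈ pPolicies k p) (r : Fin R) (κ : Fin k) (n : ℕ) (ω : Ω) :
    loynesSum (fun n => D.service n r κ) (queueArrival D π r κ) n ω =
      ∑ m ∈ Finset.range (n + 1), D.service (-(m : ℤ)) r κ ω -
        backwardSum D π r κ (phaseIndex D π r κ ω) (n + 1) ω := by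
  rw [loynesSum, Finset.sum_sub_distrib, ← sum_patternTime hπ]
  rfl

lemma loynesSum_const {S : ℤ → Ω → ℝ} (c : ℝ) (n : ℕ) (ω : Ω) :
    loynesSum S (fun _ _ => c) n ω =
      ∑ m ∈ Finset.range (n + 1), S (-(m : ℤ)) ω - ((n : ℝ) + 1) * c := by
  rw [loynesSum, Finset.sum_sub_distrib]
  simp

lemma monotone_backwardSum (hπ : π ∈ pPolicies k p) {ω : Ω} (hω : ∀ i, 0 < D.arrival i ω)
    (r : Fin R) (κ : Fin k) (j : ℤ) : Monotone fun n => backwardSum D π r κ j n ω := by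
  intro a b hab
  refine Finset.sum_le_sum_of_subset_of_nonneg (Finset.Ico_subset_Ico_left ?_)
    fun i _ _ => (hω i).le
  exact visit_mono hπ r κ (by omega)

variable [MeasurableSpace Ω] {P : Measure Ω} {τ : Measure ℝ} {ν : Fin R → Measure ℝ} {N : ℕ}

namespace Drivers.IsSystem

lemma measurable_arrival (hD : D.IsSystem P τ ν N) (n : ℤ) : Measurable (D.arrival n) :=
  hD.measurable_family (Sum.inl n)

lemma measurable_service (hD : D.IsSystem P τ ν N) (n : ℤ) (r : Fin R) (κ : Fin k) :
    Measurable (D.service n r κ) :=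
  hD.measurable_family (Sum.inr (Sum.inl (n, r, κ)))

lemma measurable_phase (hD : D.IsSystem P τ ν N) (r : Fin R) (κ : Fin k) :
    Measurable (D.phase r κ) :=
  hD.measurable_family (Sum.inr (Sum.inr (r, κ)))

lemma indep_arrival (hD : D.IsSystem P τ ν N) : iIndepFun D.arrival P :=
  hD.indep_family.precomp (g := Sum.inl) Sum.inl_injective

lemma indep_service (hD : D.IsSystem P τ ν N) (r : Fin R) (κ : Fin k) :
    iIndepFun (fun n => D.service n r κ) P :=
  hD.indep_family.precomp (g := fun n : ℤ => Sum.inr (Sum.inl (n, r, κ)))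
    fun a b hab => by simpa using hab

lemma measurable_phaseIndex (hD : D.IsSystem P τ ν N) (r : Fin R) (κ : Fin k) :
    Measurable (phaseIndex D π r κ) :=
  Int.measurable_floor.comp ((hD.measurable_phase r κ).const_mul _)

lemma arrival_pos (hD : D.IsSystem P τ ν N) (hτ_pos : τ (Set.Iic 0) = 0) :
    ∀ᵐ ω ∂P, ∀ i, 0 < D.arrival i ω := by
  rw [ae_all_iff]
  intro i
  rw [← hD.law_arrival i, Measure.map_apply (hD.measurable_arrival i) measurableSet_Iic] at hτ_pos
  rw [ae_iff]
  convert hτ_pos using 2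
  ext ω
  simp

/-- The mean interarrival time at queue `(r, κ)` is `‖p‖ / (p r λ)`. -/
lemma tendsto_backwardSum_div [IsProbabilityMeasure P] (hD : D.IsSystem P τ ν N)
    (hπ : π ∈ cyclicPolicies k p)
    (hτ_int : Integrable (fun x : ℝ => x) τ) {lam : ℝ}
    (hτ_mean : ∫ x, x ∂τ = (lam * (k : ℝ))⁻¹) (r : Fin R) (hp : 0 < p r) (κ : Fin k) :
    ∀ᵐ ω ∂P, ∀ j : ℤ, Tendsto (fun n : ℕ => backwardSum D π r κ j n ω / n) atTop
      (𝓝 ((l1norm p : ℝ) / ((p r : ℝ) * lam))) := by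
  -- There are countably many `j`, so one null set serves them all and the limit may later be taken
  -- at the random `phaseIndex`.
  rw [ae_all_iff]
  intro j
  set v := visit π r κ j
  have hslln := tendsto_sum_range_div (P := P) (X := fun m : ℕ => D.arrival (v - 1 - m))
    (fun n => hD.measurable_arrival _) (fun n => hD.law_arrival _)
    (hD.indep_arrival.precomp (g := fun m : ℕ => v - 1 - (m : ℤ))
      fun a b hab => by simpa using hab) hτ_int
  have hk : (0 : ℝ) < k := by exact_mod_cast κ.pos
  have hp' : (0 : ℝ) < p r := by exact_mod_cast hp
  have hL : (0 : ℝ) < l1norm p := by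
    have : p r ≤ l1norm p := Finset.single_le_sum (fun _ _ => Nat.zero_le _) (Finset.mem_univ r)
    exact_mod_cast hp.trans_le this
  -- The number of dispatcher jobs spanned by `n` visits; the strong law is used along this
  -- subsequence, and `c n / n` supplies the rate.
  set c : ℕ → ℕ := fun n => (v - visit π r κ (j - n)).toNat with hcdef
  have hc : ∀ n : ℕ, ((c n : ℕ) : ℤ) = v - visit π r κ (j - n) := fun n =>
    Int.toNat_of_nonneg (sub_nonneg.2 (visit_mono hπ.1 r κ (by omega)))
  have hbound : ∀ n : ℕ, |(c n : ℝ) - (k * n : ℝ) * l1norm p / p r| ≤ l1norm p := by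
    intro n
    have h := abs_visit_sub_le hπ r hp κ (j - n) n
    rw [sub_add_cancel] at h
    rw [← hc] at h
    exact_mod_cast h
  have hratio : Tendsto (fun n : ℕ => (c n : ℝ) / n) atTop (𝓝 (k * l1norm p / p r)) := by
    rw [tendsto_iff_norm_sub_tendsto_zero]
    refine squeeze_zero' (Eventually.of_forall fun n => norm_nonneg _) ?_
      (tendsto_const_div_atTop_nhds_zero_nat (l1norm p : ℝ))
    filter_upwards [eventually_gt_atTop 0] with n hn
    have hn' : (0 : ℝ) < n := by exact_mod_cast hn
    have e : (c n : ℝ) / n - k * l1norm p / p r = (c n - (k * n : ℝ) * l1norm p / p r) / n := by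
      field_simp
    rw [e, norm_div, Real.norm_eq_abs, Real.norm_of_nonneg hn'.le]
    gcongr
    exact hbound n
  have hcinf : Tendsto c atTop atTop := by
    rw [← tendsto_natCast_atTop_iff (R := ℝ)]
    have h1 : Tendsto (fun n : ℕ => (c n : ℝ) / n * n) atTop atTop :=
      hratio.pos_mul_atTop (by positivity) tendsto_natCast_atTop_atTop
    refine h1.congr' ?_
    filter_upwards [eventually_gt_atTop 0] with n hn
    have hn' : (n : ℝ) ≠ 0 := by exact_mod_cast hn.ne'
    field_simp
  filter_upwards [hslln] with ω hω
  have h2 := (hω.comp hcinf).mul hratio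
  rw [hτ_mean] at h2
  have e : (lam * (k : ℝ))⁻¹ * (k * l1norm p / p r) = (l1norm p : ℝ) / ((p r : ℝ) * lam) := by
    field_simp
  rw [e] at h2
  refine h2.congr' ?_
  filter_upwards [hcinf.eventually_gt_atTop 0] with n hn
  have hn' : (c n : ℝ) ≠ 0 := by exact_mod_cast hn.ne'
  have e3 : visit π r κ (j - n) = v - (c n : ℕ) := by rw [hc]; ring
  have e2 : backwardSum D π r κ j n ω = ∑ m ∈ Finset.range (c n), D.arrival (v - 1 - m) ω := by
    rw [backwardSum, e3]
    exact sum_Ico_eq_sum_range_sub (f := fun i => D.arrival i ω) v (c n)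
  rw [e2, Function.comp_apply]
  field_simp

/-- The mean square bound on the arrival epochs at queue `(r, κ)`. -/
lemma measure_backwardSum_fixed_le [IsProbabilityMeasure P] (hD : D.IsSystem P τ ν N)
    (hπ : π ∈ cyclicPolicies k p)
    (hτ_L2 : MemLp (fun x : ℝ => x) 2 τ) {lam : ℝ} (hlam : 0 < lam)
    (hτ_mean : ∫ x, x ∂τ = (lam * (k : ℝ))⁻¹) (r : Fin R) (hp : 0 < p r) (κ : Fin k)
    (j : ℤ) (n : ℕ) {a : ℝ} (ha : 0 < a) :
    P {ω | a ≤ |backwardSum D π r κ j (n + 1) ω -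
        ((n : ℝ) + 1) * ((l1norm p : ℝ) / ((p r : ℝ) * lam))|} ≤
      ENNReal.ofReal (((n : ℝ) + 1) * (2 * l1norm p * (k * variance (fun x : ℝ => x) τ) +
        ((l1norm p : ℝ) / (lam * k)) ^ 2) / a ^ 2) := by
  have hid := fun i => identDistrib_id_of_map_eq (hD.measurable_arrival i) (hD.law_arrival i)
  have hmem : ∀ i, MemLp (D.arrival i) 2 P := fun i => (hid i).memLp_iff.2 hτ_L2
  have hY : MemLp (backwardSum D π r κ j (n + 1)) 2 P := memLp_finsetSum _ fun i _ => hmem i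
  refine (measure_ge_abs_sub_le hY _ ha).trans (ENNReal.ofReal_le_ofReal ?_)
  gcongr
  have hk : (1 : ℝ) ≤ k := by exact_mod_cast κ.pos
  have hp' : (1 : ℝ) ≤ p r := by exact_mod_cast hp
  have hL : (0 : ℝ) < l1norm p := by
    have : p r ≤ l1norm p := Finset.single_le_sum (fun _ _ => Nat.zero_le _) (Finset.mem_univ r)
    exact_mod_cast hp.trans_le this
  set I := Finset.Ico (visit π r κ (j - (n + 1 : ℕ))) (visit π r κ j) with hI
  have hcard : |(I.card : ℝ) - (k * (n + 1 : ℕ) : ℝ) * l1norm p / p r| ≤ l1norm p := by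
    have h := abs_visit_sub_le hπ r hp κ (j - (n + 1 : ℕ)) (n + 1)
    rw [sub_add_cancel] at h
    have e : ((I.card : ℕ) : ℤ) = visit π r κ j - visit π r κ (j - (n + 1 : ℕ)) := by
      rw [hI, Int.card_Ico]
      exact Int.toNat_of_nonneg (sub_nonneg.2 (visit_mono hπ.1 r κ (by omega)))
    rw [← e] at h
    exact_mod_cast h
  have hfun : backwardSum D π r κ j (n + 1) = ∑ i ∈ I, D.arrival i := by
    funext ω
    rw [Finset.sum_apply]
    rfl
  have hmean : ∫ ω, backwardSum D π r κ j (n + 1) ω ∂P = I.card * (lam * (k : ℝ))⁻¹ := by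
    have : ∫ ω, backwardSum D π r κ j (n + 1) ω ∂P = ∑ i ∈ I, ∫ ω, D.arrival i ω ∂P :=
      integral_finsetSum _ fun i _ => (hmem i).integrable (by norm_num)
    rw [this, Finset.sum_congr rfl fun i _ => (hid i).integral_eq, hτ_mean, Finset.sum_const,
      nsmul_eq_mul]
  have hvar : variance (backwardSum D π r κ j (n + 1)) P =
      I.card * variance (fun x : ℝ => x) τ := by
    rw [hfun, IndepFun.variance_sum (fun i _ => hmem i)
      fun i _ j _ hij => hD.indep_arrival.indepFun hij,
      Finset.sum_congr rfl fun i _ => (hid i).variance_eq, Finset.sum_const, nsmul_eq_mul]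
  -- The job count is off by at most `‖p‖`, and each job has mean duration `1 / (λ k)`: the bias
  -- does not grow with `n`.
  have hbias : (I.card * (lam * (k : ℝ))⁻¹ -
      ((n : ℝ) + 1) * ((l1norm p : ℝ) / ((p r : ℝ) * lam))) ^ 2 ≤
      ((l1norm p : ℝ) / (lam * k)) ^ 2 := by
    have e : I.card * (lam * (k : ℝ))⁻¹ - ((n : ℝ) + 1) * ((l1norm p : ℝ) / ((p r : ℝ) * lam)) =
        ((I.card : ℝ) - (k * (n + 1 : ℕ) : ℝ) * l1norm p / p r) / (lam * k) := by
      push_cast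
      field_simp
    rw [e, sq_le_sq, abs_div, abs_div, abs_of_pos hL]
    gcongr
  -- The factor `2` bounds main term and error together, using `p r ≥ 1` and `1 ≤ k (n + 1)`.
  have hcard' : (I.card : ℝ) ≤ ((n : ℝ) + 1) * (2 * l1norm p * k) := by
    have h1 := (abs_le.1 hcard).2
    have h2 : (k * (n + 1 : ℕ) : ℝ) * l1norm p / p r ≤ (k * (n + 1 : ℕ) : ℝ) * l1norm p :=
      div_le_self (by positivity) hp'
    have h3 : (1 : ℝ) ≤ k * (n + 1) := by nlinarith [Nat.cast_nonneg (α := ℝ) n]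
    have h4 := mul_le_mul_of_nonneg_right h3 hL.le
    push_cast at h1 h2
    linarith
  have hv := variance_nonneg (fun x : ℝ => x) τ
  rw [hvar, hmean, mul_add]
  have h5 := mul_le_mul_of_nonneg_right hcard' hv
  have h6 : ((l1norm p : ℝ) / (lam * k)) ^ 2 ≤ ((n : ℝ) + 1) * ((l1norm p : ℝ) / (lam * k)) ^ 2 :=
    le_mul_of_one_le_left (sq_nonneg _) (by linarith [Nat.cast_nonneg (α := ℝ) n])
  have e : ((n : ℝ) + 1) * (2 * l1norm p * k) * variance (fun x : ℝ => x) τ =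
      ((n : ℝ) + 1) * (2 * l1norm p * (k * variance (fun x : ℝ => x) τ)) := by ring
  rw [e] at h5
  linarith

/-- The bound for a fixed visit is the same for every `j`, and the phase is independent of the
arrivals, so it survives the random choice of the starting visit. -/
lemma measure_backwardSum_le [IsProbabilityMeasure P] (hD : D.IsSystem P τ ν N)
    (hπ : π ∈ cyclicPolicies k p)
    (hτ_L2 : MemLp (fun x : ℝ => x) 2 τ) {lam : ℝ} (hlam : 0 < lam)
    (hτ_mean : ∫ x, x ∂τ = (lam * (k : ℝ))⁻¹) (r : Fin R) (hp : 0 < p r) (κ : Fin k)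
    (n : ℕ) {a : ℝ} (ha : 0 < a) :
    P {ω | a ≤ |backwardSum D π r κ (phaseIndex D π r κ ω) (n + 1) ω -
        ((n : ℝ) + 1) * ((l1norm p : ℝ) / ((p r : ℝ) * lam))|} ≤
      ENNReal.ofReal (((n : ℝ) + 1) * (2 * l1norm p * (k * variance (fun x : ℝ => x) τ) +
        ((l1norm p : ℝ) / (lam * k)) ^ 2) / a ^ 2) := by
  refine measure_random_index_le (hD.measurable_phaseIndex r κ)
    (E := fun j => {ω | a ≤ |backwardSum D π r κ j (n + 1) ω -
        ((n : ℝ) + 1) * ((l1norm p : ℝ) / ((p r : ℝ) * lam))|})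
    (fun j => hD.measure_backwardSum_fixed_le hπ hτ_L2 hlam hτ_mean r hp κ j n ha) fun j => ?_
  have hind := hD.indep_family.indepFun_finsetSum_of_notMem hD.measurable_family
    (s := (Finset.Ico (visit π r κ (j - (n + 1 : ℕ))) (visit π r κ j)).map
      ⟨Sum.inl, Sum.inl_injective⟩) (i := Sum.inr (Sum.inr (r, κ))) (by simp)
  have hfun : (∑ i ∈ (Finset.Ico (visit π r κ (j - (n + 1 : ℕ))) (visit π r κ j)).map
      ⟨Sum.inl, Sum.inl_injective⟩, D.family i) = backwardSum D π r κ j (n + 1) := by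
    funext ω
    rw [Finset.sum_map, Finset.sum_apply]
    rfl
  rw [hfun] at hind
  exact hind.measure_inter_preimage_eq_mul
    {x : ℝ | a ≤ |x - ((n : ℝ) + 1) * ((l1norm p : ℝ) / ((p r : ℝ) * lam))|}
    ((fun x : ℝ => ⌊(visitsPerPeriod π r κ : ℝ) * x⌋) ⁻¹' {j})
    (measurableSet_le measurable_const (by fun_prop))
    ((Int.measurable_floor.comp (measurable_id.const_mul _)) (measurableSet_singleton j))

end Drivers.IsSystem

end Drivers

/-! ### Measurability and independence of the waiting times -/

section Measurability

variable {Ω : Type*} [MeasurableSpace Ω]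

lemma measurable_stationaryWait {S T : ℤ → Ω → ℝ} (hS : ∀ n, Measurable (S n))
    (hT : ∀ n, Measurable (T n)) : Measurable (stationaryWait S T) := by
  refine Measurable.max (Measurable.iSup fun n => ?_) measurable_const
  exact Finset.measurable_fun_sum _ fun m _ => (hS _).sub (hT _)

variable {R k : ℕ} {D : Drivers R k Ω}

lemma measurable_queueArrival (hD : ∀ i, Measurable (D.family i)) (π : Policy R k) (r : Fin R)
    (κ : Fin k) (n : ℤ) : Measurable (queueArrival D π r κ n) := by
  have hj : ∀ j, Measurable (patternTime D π r κ j) := fun j =>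
    Finset.measurable_fun_sum (Finset.Ico (visit π r κ j) (visit π r κ (j + 1)))
      fun i _ => (hD (Sum.inl i) : Measurable (D.arrival i))
  have hphase : Measurable (D.phase r κ) := hD (Sum.inr (Sum.inr (r, κ)))
  -- Evaluation at a random index is measurable because the index set `ℤ` is countable.
  have h1 : Measurable fun x : Ω × ℤ => patternTime D π r κ x.2 x.1 :=
    measurable_from_prod_countable_left hj
  have h2 : Measurable fun ω => ⌊(visitsPerPeriod π r κ : ℝ) * D.phase r κ ω⌋ + (n - 1) :=
    (Int.measurable_floor.comp (hphase.const_mul _)).add_const _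
  have h3 := h1.comp (measurable_id.prodMk h2)
  simp only [Function.comp_def, id] at h3
  exact h3

lemma measurable_queueWait (hD : ∀ i, Measurable (D.family i)) (π : Policy R k) (r : Fin R)
    (κ : Fin k) : Measurable (queueWait D π r κ) :=
  measurable_stationaryWait (fun n => hD (Sum.inr (Sum.inl (n, r, κ))))
    (measurable_queueArrival hD π r κ)

/-- The drivers on the canonical space. -/
def canonicalDrivers (R k : ℕ) :
    Drivers R k (ℤ ⊕ (ℤ × Fin R × Fin k) ⊕ (Fin R × Fin k) → ℝ) where
  arrival n x := x (Sum.inl n)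
  service n r κ x := x (Sum.inr (Sum.inl (n, r, κ)))
  phase r κ x := x (Sum.inr (Sum.inr (r, κ)))
  start _ := 0

lemma measurable_canonicalDrivers (i : ℤ ⊕ (ℤ × Fin R × Fin k) ⊕ (Fin R × Fin k)) :
    Measurable ((canonicalDrivers R k).family i) := by
  rcases i with i | i | i <;> exact measurable_pi_apply _

/-- On the canonical space `queueWait` is a measurable function of the family of real drivers alone;
composing it with that family gives back the original, up to definitional unfolding. -/
lemma Drivers.IsSystem.indepFun_queueWait_start {P : Measure Ω} {τ : Measure ℝ}
    {ν : Fin R → Measure ℝ} {N : ℕ} (hD : D.IsSystem P τ ν N) (π : Policy R k) (r : Fin R)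
    (κ : Fin k) : IndepFun (queueWait D π r κ) D.start P :=
  hD.indep_start.comp (φ := queueWait (canonicalDrivers R k) π r κ) (ψ := id)
    (measurable_queueWait measurable_canonicalDrivers π r κ) measurable_id

lemma LimitDrivers.IsSystem.indepFun_limitQueueWait_select {P : Measure Ω}
    {L : LimitDrivers R Ω} {ν : Fin R → Measure ℝ} {p : Fin R → ℕ} (hL : L.IsSystem P ν p)
    (lam : ℝ) (r : Fin R) : IndepFun (limitQueueWait L lam p r) L.select P :=
  hL.indep_select.comp
    (φ := stationaryWait (fun (n : ℤ) (x : ℤ × Fin R → ℝ) => x (n, r)) (detArrival _ lam p r))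
    (ψ := id) (measurable_stationaryWait (fun _ => measurable_pi_apply _)
      fun _ => measurable_const) measurable_id

lemma LimitDrivers.IsSystem.measurable_limitQueueWait {P : Measure Ω}
    {L : LimitDrivers R Ω} {ν : Fin R → Measure ℝ} {p : Fin R → ℕ} (hL : L.IsSystem P ν p)
    (lam : ℝ) (r : Fin R) : Measurable (limitQueueWait L lam p r) :=
  measurable_stationaryWait (fun n => hL.measurable_service n r) fun _ => measurable_const

end Measurability

/-! ### Expectations of mixtures and of nearby variables -/

section Mixture

variable {Ω : Type*} [MeasurableSpace Ω] {P : Measure Ω} [IsProbabilityMeasure P]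

/-- The expectation of a function of a mixture. -/
lemma integral_comp_mixture {ι β : Type*} [Fintype ι] [MeasurableSpace β] {V : Ω → β}
    (hV : Measurable V) {A : ι → Set β} (hA : ∀ i, MeasurableSet (A i)) {W : ι → Ω → ℝ}
    (hW : ∀ i, Measurable (W i)) (hind : ∀ i, IndepFun (W i) V P)
    (hpart : ∀ᵐ ω ∂P, ∃! i, V ω ∈ A i) {f : ℝ → ℝ} (hf : Measurable f) {C : ℝ}
    (hC : ∀ x, |f x| ≤ C) :
    ∫ ω, f (∑ i, (V ⁻¹' A i).indicator (W i) ω) ∂P =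
      ∑ i, P.real (V ⁻¹' A i) * ∫ ω, f (W i ω) ∂P := by
  -- Exactly one indicator is active almost surely, so `f` passes through the sum even if `f 0 ≠ 0`.
  have hae : (fun ω => f (∑ i, (V ⁻¹' A i).indicator (W i) ω)) =ᵐ[P]
      fun ω => ∑ i, (A i).indicator (fun _ => (1 : ℝ)) (V ω) * f (W i ω) := by
    filter_upwards [hpart] with ω ⟨i, hi, huniq⟩
    rw [Finset.sum_eq_single i, Finset.sum_eq_single i]
    · rw [Set.indicator_of_mem hi, Set.indicator_of_mem (show ω ∈ V ⁻¹' A i from hi), one_mul]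
    · intro j _ hj
      rw [Set.indicator_of_notMem (show V ω ∉ A j from fun h => hj (huniq j h)), zero_mul]
    · simp
    · intro j _ hj
      exact Set.indicator_of_notMem (show ω ∉ V ⁻¹' A j from fun h => hj (huniq j h)) _
    · simp
  have hmeas : ∀ i, Measurable ((A i).indicator fun _ => (1 : ℝ)) := fun i =>
    measurable_const.indicator (hA i)
  rw [integral_congr_ae hae, integral_finsetSum]
  · refine Finset.sum_congr rfl fun i _ => ?_
    rw [(hind i).symm.integral_fun_comp_mul_comp hV.aemeasurable (hW i).aemeasurable
      (hmeas i).aestronglyMeasurable hf.aestronglyMeasurable]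
    congr 1
    rw [← integral_indicator_one (hV (hA i))]
    rfl
  · intro i _
    refine Integrable.of_bound (C := C)
      (((hmeas i).comp hV).mul (hf.comp (hW i))).aestronglyMeasurable (ae_of_all _ fun ω => ?_)
    rw [norm_mul, Real.norm_eq_abs, Real.norm_eq_abs]
    have h1 : |(A i).indicator (fun _ => (1 : ℝ)) (V ω)| ≤ 1 := by
      by_cases h : V ω ∈ A i <;> simp [h]
    calc _ ≤ 1 * C := mul_le_mul h1 (hC _) (abs_nonneg _) zero_le_one
      _ = C := one_mul C

/-- Expectations of a bounded Lipschitz function at two random variables that are close in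
probability. -/
lemma abs_integral_sub_integral_le {X Y : Ω → ℝ} (hX : Measurable X) (hY : Measurable Y)
    {f : ℝ → ℝ} {K : NNReal} (hf : LipschitzWith K f) {B C : ℝ} (hB : ∀ x, |f x| ≤ B)
    (hC : ∀ x y, dist (f x) (f y) ≤ C) {ε : ℝ} (hε : 0 ≤ ε) :
    |∫ ω, f (X ω) ∂P - ∫ ω, f (Y ω) ∂P| ≤ K * ε + C * P.real {ω | ε < |X ω - Y ω|} := by
  have hfm := hf.continuous.measurable
  have hint : ∀ {Z : Ω → ℝ}, Measurable Z → Integrable (fun ω => f (Z ω)) P := fun hZ =>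
    Integrable.of_bound (C := B) (hfm.comp hZ).aestronglyMeasurable (ae_of_all _ fun ω => hB _)
  have hset : MeasurableSet {ω | ε < |X ω - Y ω|} :=
    measurableSet_lt measurable_const (hX.sub hY).abs
  have hC0 : 0 ≤ C := dist_nonneg.trans (hC 0 0)
  rw [← integral_sub (hint hX) (hint hY)]
  refine (abs_integral_le_integral_abs).trans ?_
  have hind : Integrable ({ω | ε < |X ω - Y ω|}.indicator fun _ => C) P :=
    (integrable_const C).indicator hset
  calc ∫ ω, |f (X ω) - f (Y ω)| ∂P
      ≤ ∫ ω, ((K * ε : ℝ) + {ω | ε < |X ω - Y ω|}.indicator (fun _ => C) ω) ∂P := by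
        refine integral_mono ((hint hX).sub (hint hY)).abs ((integrable_const _).add hind)
          fun ω => ?_
        dsimp only
        by_cases h : ω ∈ {ω | ε < |X ω - Y ω|}
        · rw [Set.indicator_of_mem h, ← Real.dist_eq]
          have h1 := hC (X ω) (Y ω)
          have h2 : 0 ≤ (K : ℝ) * ε := mul_nonneg K.2 hε
          linarith
        · rw [Set.indicator_of_notMem h, ← Real.dist_eq, add_zero]
          have h' : |X ω - Y ω| ≤ ε := not_lt.1 h
          refine (hf.dist_le_mul _ _).trans ?_
          rw [Real.dist_eq]
          gcongr
    _ = K * ε + C * P.real {ω | ε < |X ω - Y ω|} := by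
        rw [integral_add (integrable_const _) hind, integral_const, integral_indicator_const _ hset]
        simp [mul_comm]

end Mixture

/-! ### Service sums and the strong law -/

section ServiceSums

variable {Ω : Type*} [MeasurableSpace Ω] {P : Measure Ω} {m : Measure ℝ} {S : ℤ → Ω → ℝ}

lemma tendsto_service_sum_div (hS : ∀ n, Measurable (S n)) (hlaw : ∀ n, P.map (S n) = m)
    (hind : iIndepFun S P) (hint : Integrable (fun x : ℝ => x) m) :
    ∀ᵐ ω ∂P, Tendsto (fun n : ℕ =>
      (∑ i ∈ Finset.range (n + 1), S (-(i : ℤ)) ω) / ((n : ℝ) + 1)) atTop (𝓝 (∫ x, x ∂m)) := by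
  filter_upwards [tendsto_sum_range_div (X := fun i : ℕ => S (-(i : ℤ))) (fun n => hS _)
    (fun n => hlaw _) (hind.precomp (g := fun i : ℕ => -(i : ℤ))
      fun a b hab => by simpa using hab) hint] with ω hω
  simpa [Function.comp_def] using hω.comp (tendsto_add_atTop_nat 1)

/-- The events decrease in `M`, and on their intersection slope `c` is exceeded infinitely often,
which the strong law forbids almost surely. Continuity from above concludes. -/
lemma tendsto_measure_exists_service_sum_gt [IsProbabilityMeasure P]
    (hS : ∀ n, Measurable (S n)) (hlaw : ∀ n, P.map (S n) = m)
    (hind : iIndepFun S P) (hint : Integrable (fun x : ℝ => x) m) {c : ℝ} (hc : ∫ x, x ∂m < c) :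
    Tendsto (fun M : ℕ => P {ω | ∃ n ≥ M, ((n : ℝ) + 1) * c <
      ∑ i ∈ Finset.range (n + 1), S (-(i : ℤ)) ω}) atTop (𝓝 0) := by
  have hmeas : ∀ M : ℕ, MeasurableSet {ω | ∃ n ≥ M, ((n : ℝ) + 1) * c <
      ∑ i ∈ Finset.range (n + 1), S (-(i : ℤ)) ω} := by
    intro M
    have e : {ω | ∃ n ≥ M, ((n : ℝ) + 1) * c < ∑ i ∈ Finset.range (n + 1), S (-(i : ℤ)) ω} =
        ⋃ n ≥ M, {ω | ((n : ℝ) + 1) * c < ∑ i ∈ Finset.range (n + 1), S (-(i : ℤ)) ω} := by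
      ext ω
      simp
    rw [e]
    exact MeasurableSet.iUnion fun n => MeasurableSet.iUnion fun _ =>
      measurableSet_lt measurable_const (Finset.measurable_fun_sum _ fun i _ => hS _)
  have h := tendsto_measure_iInter_atTop (μ := P) (fun M => (hmeas M).nullMeasurableSet)
    (fun a b hab ω ⟨n, hn, hω⟩ => ⟨n, hab.trans hn, hω⟩) ⟨0, measure_ne_top _ _⟩
  have hzero : P (⋂ M : ℕ, {ω | ∃ n ≥ M, ((n : ℝ) + 1) * c <
      ∑ i ∈ Finset.range (n + 1), S (-(i : ℤ)) ω}) = 0 := by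
    have hae := tendsto_service_sum_div hS hlaw hind hint
    rw [measure_eq_zero_iff_ae_notMem]
    filter_upwards [hae] with ω hω hmem
    obtain ⟨M, hM⟩ := eventually_atTop.1 (hω.eventually (gt_mem_nhds hc))
    obtain ⟨n, hn, hlt⟩ := Set.mem_iInter.1 hmem M
    have h1 := hM n hn
    rw [div_lt_iff₀ (by positivity)] at h1
    linarith
  rw [hzero] at h
  exact h

lemma ae_bddAbove_loynesSum_const (hS : ∀ n, Measurable (S n)) (hlaw : ∀ n, P.map (S n) = m)
    (hind : iIndepFun S P) (hint : Integrable (fun x : ℝ => x) m) {c : ℝ} (hc : ∫ x, x ∂m < c) :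
    ∀ᵐ ω ∂P, BddAbove (Set.range fun n : ℕ => loynesSum S (fun _ _ => c) n ω) := by
  filter_upwards [tendsto_service_sum_div hS hlaw hind hint] with ω hω
  refine bddAbove_range_of_tendsto_div (sub_neg.2 hc) ((hω.sub_const c).congr fun n => ?_)
  rw [loynesSum_const]
  field_simp

end ServiceSums

/-! ### The system and its limit as mixtures -/

section Start

variable {R k : ℕ} {π : Policy R k} {Ω : Type*} [MeasurableSpace Ω] {P : Measure Ω}
  {D : Drivers R k Ω} {τ : Measure ℝ} {ν : Fin R → Measure ℝ} {N : ℕ}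

lemma Drivers.IsSystem.measure_start_mem (hD : D.IsSystem P τ ν N) {s : Finset ℕ}
    (hs : s ⊆ Finset.Icc 1 N) : P (D.start ⁻¹' s) = s.card * (N : ENNReal)⁻¹ := by
  rw [← sum_measure_preimage_singleton s
    fun i _ => hD.measurable_start (measurableSet_singleton i),
    Finset.sum_congr rfl fun i hi => hD.law_start i (hs hi), Finset.sum_const, nsmul_eq_mul]

/-- The law of `V` is prescribed only at the points `1, …, N`; their masses already add up to `1`.
-/
lemma Drivers.IsSystem.ae_start_mem [IsProbabilityMeasure P] (hD : D.IsSystem P τ ν N)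
    (hN : 0 < N) :
    ∀ᵐ ω ∂P, D.start ω ∈ Finset.Icc 1 N := by
  have h := hD.measure_start_mem (Finset.Subset.refl _)
  rw [Nat.card_Icc, Nat.add_sub_cancel, ENNReal.mul_inv_cancel (by exact_mod_cast hN.ne')
    (ENNReal.natCast_ne_top N)] at h
  have hm : MeasurableSet (D.start ⁻¹' (Finset.Icc 1 N : Finset ℕ)) :=
    hD.measurable_start (Finset.measurableSet _)
  exact (mem_ae_iff_prob_eq_one hm).2 h

lemma Drivers.IsSystem.measurable_systemWait (hD : D.IsSystem P τ ν N) (π : Policy R k)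
    (Q : Fin R → Fin k → Finset ℕ) : Measurable (systemWait D π Q) := by
  refine Finset.measurable_fun_sum _ fun r _ => Finset.measurable_fun_sum _ fun κ _ => ?_
  exact Measurable.ite (hD.measurable_start (Finset.measurableSet _))
    (measurable_queueWait hD.measurable_family π r κ) measurable_const

lemma Drivers.IsSystem.integral_comp_systemWait [IsProbabilityMeasure P] {p : Fin R → ℕ}
    (hD : D.IsSystem P τ ν (period π)) (hπ : π ∈ pPolicies k p) {Q : Fin R → Fin k → Finset ℕ}
    (hQ : IsVisitPartition π Q) {f : ℝ → ℝ} (hf : Measurable f) {B : ℝ} (hB : ∀ x, |f x| ≤ B) :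
    ∫ ω, f (systemWait D π Q ω) ∂P =
      ∑ r, ∑ κ, (visitsPerPeriod π r κ : ℝ) / period π * ∫ ω, f (queueWait D π r κ ω) ∂P := by
  have hN := (period_spec hπ).1
  have h := integral_comp_mixture (P := P) hD.measurable_start
    (A := fun i : Fin R × Fin k => (Q i.1 i.2 : Set ℕ)) (fun i => Finset.measurableSet _)
    (W := fun i => queueWait D π i.1 i.2)
    (fun i => measurable_queueWait hD.measurable_family π i.1 i.2)
    (fun i => hD.indepFun_queueWait_start π i.1 i.2) ?_ hf hB
  · rw [Fintype.sum_prod_type] at h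
    convert h using 1
    · congr 1
      funext ω
      rw [Fintype.sum_prod_type]
      refine congrArg f (Finset.sum_congr rfl fun r _ => Finset.sum_congr rfl fun κ _ => ?_)
      by_cases hm : D.start ω ∈ Q r κ <;> simp [hm]
    · refine Finset.sum_congr rfl fun r _ => Finset.sum_congr rfl fun κ _ => ?_
      have hsub : Q r κ ⊆ Finset.Icc 1 (period π) := fun i hi => (hQ.2.1 i).1 ⟨r, κ, hi⟩
      rw [measureReal_def, hD.measure_start_mem hsub, hQ.2.2 r κ]
      simp [div_eq_mul_inv]
  · filter_upwards [hD.ae_start_mem hN] with ω hω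
    obtain ⟨r, κ, h⟩ := (hQ.2.1 _).2 hω
    refine ⟨(r, κ), h, fun i hi => ?_⟩
    by_contra hne
    exact Finset.disjoint_left.1 (hQ.1 i.1 i.2 r κ hne) hi h

end Start

section Limit

variable {R : ℕ} {p : Fin R → ℕ} {Ω : Type*} [MeasurableSpace Ω] {P : Measure Ω}
  {L : LimitDrivers R Ω} {ν : Fin R → Measure ℝ}

lemma LimitDrivers.IsSystem.indep_service_queue (hL : L.IsSystem P ν p) (r : Fin R) :
    iIndepFun (fun n => L.service n r) P :=
  hL.indep_service.precomp (g := fun n : ℤ => (n, r)) fun a b hab => by simpa using hab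

lemma LimitDrivers.IsSystem.measurable_limitWait (hL : L.IsSystem P ν p) (lam : ℝ) :
    Measurable (limitWait L lam p) := by
  refine Finset.measurable_fun_sum _ fun r _ => ?_
  exact Measurable.ite (hL.measurable_select (measurableSet_singleton r))
    (hL.measurable_limitQueueWait lam r) measurable_const

lemma LimitDrivers.IsSystem.integral_comp_limitWait [IsProbabilityMeasure P]
    (hL : L.IsSystem P ν p) (lam : ℝ) {f : ℝ → ℝ} (hf : Measurable f) {B : ℝ}
    (hB : ∀ x, |f x| ≤ B) :
    ∫ ω, f (limitWait L lam p ω) ∂P =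
      ∑ r, (p r : ℝ) / l1norm p * ∫ ω, f (limitQueueWait L lam p r ω) ∂P := by
  have h := integral_comp_mixture (P := P) hL.measurable_select
    (A := fun r : Fin R => {r}) (fun r => measurableSet_singleton r)
    (W := fun r => limitQueueWait L lam p r) (fun r => hL.measurable_limitQueueWait lam r)
    (fun r => hL.indepFun_limitQueueWait_select lam r)
    (ae_of_all _ fun ω => ⟨L.select ω, rfl, fun r hr => hr.symm⟩) hf hB
  convert h using 1
  · congr 1
    funext ω
    refine congrArg f (Finset.sum_congr rfl fun r _ => ?_)
    by_cases hm : L.select ω = r <;> simp [hm]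
  · refine Finset.sum_congr rfl fun r _ => ?_
    rw [measureReal_def, hL.law_select r, ENNReal.toReal_ofReal (by positivity)]

end Limit

/-! ### Coupling with deterministic arrivals -/

section Coupling

variable {R k : ℕ} {p : Fin R → ℕ} {π : Policy R k} {Ω Ω' : Type*} [MeasurableSpace Ω]
  [MeasurableSpace Ω'] {P : Measure Ω} {P' : Measure Ω'}
  {D : Drivers R k Ω} {L : LimitDrivers R Ω'} {τ : Measure ℝ}
  {ν : Fin R → Measure ℝ} {N : ℕ}

lemma identDistrib_service (hD : D.IsSystem P τ ν N) (hL : L.IsSystem P' ν p) (r : Fin R)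
    (κ : Fin k) :
    IdentDistrib (fun ω n => D.service n r κ ω) (fun ω n => L.service n r ω) P P' :=
  IdentDistrib.pi (fun n => ⟨(hD.measurable_service n r κ).aemeasurable,
    (hL.measurable_service n r).aemeasurable, by rw [hD.law_service, hL.law_service]⟩)
    (hD.indep_service r κ) (hL.indep_service_queue r)

/-- The waiting time at queue `(r, κ)` when its arrivals are replaced by deterministic ones. -/
noncomputable def deterministicWait (D : Drivers R k Ω) (lam : ℝ) (p : Fin R → ℕ) (r : Fin R)
    (κ : Fin k) : Ω → ℝ :=
  stationaryWait (fun n => D.service n r κ) (detArrival Ω lam p r)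

lemma identDistrib_deterministicWait (hD : D.IsSystem P τ ν N) (hL : L.IsSystem P' ν p)
    (lam : ℝ) (r : Fin R) (κ : Fin k) :
    IdentDistrib (deterministicWait D lam p r κ) (limitQueueWait L lam p r) P P' :=
  (identDistrib_service hD hL r κ).comp
    (u := stationaryWait (fun (n : ℤ) (x : ℤ → ℝ) => x n) (detArrival _ lam p r))
    (measurable_stationaryWait (fun _ => measurable_pi_apply _) fun _ => measurable_const)

lemma measurable_deterministicWait (hD : D.IsSystem P τ ν N) (lam : ℝ) (r : Fin R) (κ : Fin k) :
    Measurable (deterministicWait D lam p r κ) :=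
  measurable_stationaryWait (fun n => hD.measurable_service n r κ) fun _ => measurable_const

/-- Transferring the service event to the limit space makes its probability visibly independent of
`k` and `κ`, so that a single `M` serves all systems. -/
lemma measure_exists_service_sum_gt_eq (hD : D.IsSystem P τ ν N) (hL : L.IsSystem P' ν p)
    (r : Fin R) (κ : Fin k) (c : ℝ) (M : ℕ) :
    P {ω | ∃ n ≥ M, ((n : ℝ) + 1) * c <
        ∑ i ∈ Finset.range (n + 1), D.service (-(i : ℤ)) r κ ω} =
      P' {ω | ∃ n ≥ M, ((n : ℝ) + 1) * c <
        ∑ i ∈ Finset.range (n + 1), L.service (-(i : ℤ)) r ω} := by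
  refine (identDistrib_service hD hL r κ).measure_mem_eq
    (s := {x : ℤ → ℝ | ∃ n ≥ M, ((n : ℝ) + 1) * c < ∑ i ∈ Finset.range (n + 1), x (-(i : ℤ))}) ?_
  have e : {x : ℤ → ℝ | ∃ n ≥ M, ((n : ℝ) + 1) * c <
      ∑ i ∈ Finset.range (n + 1), x (-(i : ℤ))} =
      ⋃ n ≥ M, {x : ℤ → ℝ | ((n : ℝ) + 1) * c < ∑ i ∈ Finset.range (n + 1), x (-(i : ℤ))} := by
    ext x
    simp
  rw [e]
  exact MeasurableSet.iUnion fun n => MeasurableSet.iUnion fun _ =>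
    measurableSet_lt measurable_const (Finset.measurable_fun_sum _ fun i _ => measurable_pi_apply _)

/-- By the strong law for services and for arrivals, the walk has the negative drift `E S - c`. -/
lemma ae_bddAbove_loynesSum_queue [IsProbabilityMeasure P] (hD : D.IsSystem P τ ν N) (hπ : π ∈ cyclicPolicies k p)
    (hτ_int : Integrable (fun x : ℝ => x) τ) {lam : ℝ}
    (hτ_mean : ∫ x, x ∂τ = (lam * (k : ℝ))⁻¹) {r : Fin R}
    (hν_int : Integrable (fun x : ℝ => x) (ν r)) (hp : 0 < p r)
    (hc : ∫ x, x ∂(ν r) < (l1norm p : ℝ) / ((p r : ℝ) * lam)) (κ : Fin k) :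
    ∀ᵐ ω ∂P, BddAbove (Set.range fun n : ℕ =>
      loynesSum (fun n => D.service n r κ) (queueArrival D π r κ) n ω) := by
  filter_upwards [tendsto_service_sum_div (fun n => hD.measurable_service n r κ)
    (fun n => hD.law_service n r κ) (hD.indep_service r κ) hν_int,
    hD.tendsto_backwardSum_div hπ hτ_int hτ_mean r hp κ] with ω h1 h2
  have h3 := (h2 (phaseIndex D π r κ ω)).comp (tendsto_add_atTop_nat 1)
  refine bddAbove_range_of_tendsto_div (sub_neg.2 hc) ((h1.sub h3).congr fun n => ?_)
  rw [loynesSum_queueArrival hπ.1, Function.comp_apply, sub_div]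
  push_cast
  rfl

lemma measure_queueWait_sub_le [IsProbabilityMeasure P] (hD : D.IsSystem P τ ν N) (hL : L.IsSystem P' ν p)
    (hπ : π ∈ cyclicPolicies k p) (hτ_pos : τ (Set.Iic 0) = 0)
    (hτ_L2 : MemLp (fun x : ℝ => x) 2 τ) {lam : ℝ} (hlam : 0 < lam)
    (hτ_mean : ∫ x, x ∂τ = (lam * (k : ℝ))⁻¹) {r : Fin R} (hp : 0 < p r) (κ : Fin k)
    {c' c'' ε : ℝ} (hc' : 0 < c') (hc'' : c' < c'')
    (hc : c'' < (l1norm p : ℝ) / ((p r : ℝ) * lam)) (hε : 0 < ε) {m₀ M : ℕ} (h0 : 0 < m₀)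
    (hm₀ : ∀ m ≥ m₀, ((m : ℝ) + 1) ^ 2 * c' ≤ (m : ℝ) ^ 2 * c'') (hM : m₀ ^ 2 ≤ M) :
    P {ω | ε < |queueWait D π r κ ω - deterministicWait D lam p r κ ω|} ≤
      P' {ω | ∃ n ≥ M, ((n : ℝ) + 1) * c' <
        ∑ i ∈ Finset.range (n + 1), L.service (-(i : ℤ)) r ω} +
      ENNReal.ofReal ((2 * l1norm p * (k * variance (fun x : ℝ => x) τ) +
        ((l1norm p : ℝ) / (lam * k)) ^ 2) * (M * (M / ε ^ 2) +
          (∑' m : ℕ, 1 / ((m : ℝ) + 1) ^ 2) /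
            ((l1norm p : ℝ) / ((p r : ℝ) * lam) - c'') ^ 2)) := by
  have hmono : ∀ᵐ ω ∂P,
      Monotone fun n => backwardSum D π r κ (phaseIndex D π r κ ω) (n + 1) ω := by
    filter_upwards [hD.arrival_pos hτ_pos] with ω hω
    exact (monotone_backwardSum hπ.1 hω r κ _).comp fun a b hab => Nat.succ_le_succ hab
  have hv := variance_nonneg (fun x : ℝ => x) τ
  have h := measure_wait_sub_wait_le hc' hc'' hc hε
    (t := 2 * l1norm p * (k * variance (fun x : ℝ => x) τ) + ((l1norm p : ℝ) / (lam * k)) ^ 2)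
    (by positivity) h0 hm₀ hM
    (X := fun n ω => ∑ i ∈ Finset.range (n + 1), D.service (-(i : ℤ)) r κ ω) hmono
    fun n a ha => hD.measure_backwardSum_le hπ hτ_L2 hlam hτ_mean r hp κ n ha
  rw [measure_exists_service_sum_gt_eq hD hL r κ] at h
  refine le_trans (le_of_eq ?_) h
  congr 1
  ext ω
  have hdet : detArrival Ω lam p r = fun _ _ => (l1norm p : ℝ) / ((p r : ℝ) * lam) := rfl
  simp only [queueWait, deterministicWait, stationaryWait, loynesSum_queueArrival hπ.1, hdet,
    loynesSum_const]

end Coupling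

/-! ### Uniform estimates as the number of queues grows -/

section Convergence

variable {R : ℕ} {p : Fin R → ℕ} {lam : ℝ} {ν : Fin R → Measure ℝ} {τ : ℕ+ → Measure ℝ}
  {π : (k : ℕ+) → Policy R k} {Ω : ℕ+ → Type*} [∀ k, MeasurableSpace (Ω k)]
  {P : (k : ℕ+) → Measure (Ω k)} [∀ k, IsProbabilityMeasure (P k)]
  {D : (k : ℕ+) → Drivers R k (Ω k)} {N : ℕ+ → ℕ}
  {Ω' : Type*} [MeasurableSpace Ω'] {P' : Measure Ω'} [IsProbabilityMeasure P']
  {L : LimitDrivers R Ω'}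

lemma tendsto_mul_variance_add (p : Fin R → ℕ) (lam : ℝ)
    (hτ_var : (fun k : ℕ+ => variance (fun x : ℝ => x) (τ k)) =o[atTop]
      (fun k : ℕ+ => 1 / (k : ℝ))) :
    Tendsto (fun k : ℕ+ => 2 * (l1norm p : ℝ) * (k * variance (fun x : ℝ => x) (τ k)) +
      ((l1norm p : ℝ) / (lam * k)) ^ 2) atTop (𝓝 0) := by
  have h1 : Tendsto (fun k : ℕ+ => (k : ℝ) * variance (fun x : ℝ => x) (τ k)) atTop (𝓝 0) := by
    refine hτ_var.tendsto_div_nhds_zero.congr fun k => ?_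
    rw [div_div_eq_mul_div, div_one, mul_comm]
  have hk : Tendsto (fun k : ℕ+ => ((k : ℕ) : ℝ)) atTop atTop :=
    PNat.tendsto_comp_val_iff.2 tendsto_natCast_atTop_atTop
  have h2 : Tendsto (fun k : ℕ+ => (l1norm p : ℝ) / (lam * k)) atTop (𝓝 0) := by
    have h3 := (tendsto_const_nhds (x := (l1norm p : ℝ) / lam)).div_atTop hk
    exact h3.congr fun k => by rw [div_div]
  simpa using (h1.const_mul (2 * (l1norm p : ℝ))).add (h2.pow 2)

/-- The stationary waiting times of the queues of type `r` are uniformly close in probability to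
those with deterministic arrivals. -/
lemma eventually_measure_queueWait_sub_le (hlam : 0 < lam)
    (hτ_pos : ∀ k, τ k (Set.Iic 0) = 0)
    (hτ_mean : ∀ k : ℕ+, ∫ x, x ∂(τ k) = (lam * (k : ℝ))⁻¹)
    (hτ_L2 : ∀ᶠ k in atTop, MemLp (fun x : ℝ => x) 2 (τ k))
    (hτ_var : (fun k : ℕ+ => variance (fun x : ℝ => x) (τ k)) =o[atTop]
      (fun k : ℕ+ => 1 / (k : ℝ)))
    (hπ : ∀ k : ℕ+, π k ∈ cyclicPolicies (k : ℕ) p)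
    (hD : ∀ k, (D k).IsSystem (P k) (τ k) ν (N k)) (hL : L.IsSystem P' ν p) {r : Fin R}
    (hp : 0 < p r) (hν_int : Integrable (fun x : ℝ => x) (ν r)) (hν_mean : 0 < ∫ x, x ∂(ν r))
    (hc : ∫ x, x ∂(ν r) < (l1norm p : ℝ) / ((p r : ℝ) * lam)) {ε η : ℝ} (hε : 0 < ε)
    (hη : 0 < η) :
    ∀ᶠ k : ℕ+ in atTop, ∀ κ : Fin k, (P k).real {ω | ε <
      |queueWait (D k) (π k) r κ ω - deterministicWait (D k) lam p r κ ω|} ≤ η := by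
  -- Order of choices: the slopes, then `m₀`, then `M` from the services; only then is `k` taken
  -- large, so that the arrival term vanishes with `M` fixed.
  obtain ⟨c', h1, h2⟩ := exists_between hc
  obtain ⟨c'', h3, h4⟩ := exists_between h2
  obtain ⟨m₀, h0, hm₀⟩ := exists_sq_ratio (hν_mean.trans h1) h3
  have hη2 : (0 : ENNReal) < ENNReal.ofReal (η / 2) := ENNReal.ofReal_pos.2 (by linarith)
  obtain ⟨M, hM, hmM⟩ := (((tendsto_measure_exists_service_sum_gt
    (fun n => hL.measurable_service n r) (fun n => hL.law_service n r) (hL.indep_service_queue r)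
    hν_int h1).eventually (ge_mem_nhds hη2)).and (eventually_ge_atTop (m₀ ^ 2))).exists
  have ht := (tendsto_mul_variance_add p lam hτ_var).mul_const (M * (M / ε ^ 2) +
    (∑' m : ℕ, 1 / ((m : ℝ) + 1) ^ 2) / ((l1norm p : ℝ) / ((p r : ℝ) * lam) - c'') ^ 2)
  rw [zero_mul] at ht
  -- `variance` is the default `0` when the second moment is infinite, so its decay alone would not
  -- give membership in `L²`.
  filter_upwards [ht.eventually (ge_mem_nhds (show (0 : ℝ) < η / 2 by linarith)), hτ_L2]
    with k hk hk2 κ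
  have h := measure_queueWait_sub_le (hD k) hL (hπ k) (hτ_pos k) hk2 hlam (hτ_mean k) hp κ
    (hν_mean.trans h1) h3 h4 hε h0 hm₀ hmM
  refine ENNReal.toReal_le_of_le_ofReal hη.le (h.trans ?_)
  calc _ ≤ ENNReal.ofReal (η / 2) + ENNReal.ofReal (η / 2) :=
        add_le_add hM (ENNReal.ofReal_le_ofReal hk)
    _ = ENNReal.ofReal η := by
        rw [← ENNReal.ofReal_add (by linarith) (by linarith), add_halves]

lemma eventually_abs_integral_queueWait_sub_le (hlam : 0 < lam)
    (hτ_pos : ∀ k, τ k (Set.Iic 0) = 0)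
    (hτ_mean : ∀ k : ℕ+, ∫ x, x ∂(τ k) = (lam * (k : ℝ))⁻¹)
    (hτ_L2 : ∀ᶠ k in atTop, MemLp (fun x : ℝ => x) 2 (τ k))
    (hτ_var : (fun k : ℕ+ => variance (fun x : ℝ => x) (τ k)) =o[atTop]
      (fun k : ℕ+ => 1 / (k : ℝ)))
    (hπ : ∀ k : ℕ+, π k ∈ cyclicPolicies (k : ℕ) p)
    (hD : ∀ k, (D k).IsSystem (P k) (τ k) ν (N k)) (hL : L.IsSystem P' ν p) {r : Fin R}
    (hp : 0 < p r) (hν_int : Integrable (fun x : ℝ => x) (ν r)) (hν_mean : 0 < ∫ x, x ∂(ν r))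
    (hc : ∫ x, x ∂(ν r) < (l1norm p : ℝ) / ((p r : ℝ) * lam)) {f : ℝ → ℝ} {K : NNReal}
    (hf : LipschitzWith K f) {B C : ℝ} (hB : ∀ x, |f x| ≤ B) (hC : ∀ x y, dist (f x) (f y) ≤ C)
    {δ : ℝ} (hδ : 0 < δ) :
    ∀ᶠ k : ℕ+ in atTop, ∀ κ : Fin k, |∫ ω, f (queueWait (D k) (π k) r κ ω) ∂(P k) -
      ∫ ω, f (limitQueueWait L lam p r ω) ∂P'| ≤ δ := by
  have hC0 : 0 ≤ C := dist_nonneg.trans (hC 0 0)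
  have hK0 : (0 : ℝ) ≤ K := K.2
  -- Half of `δ` pays for the Lipschitz term and half for the exceptional event; the `+ 1` avoids
  -- dividing by zero when `K` or `C` vanishes.
  filter_upwards [eventually_measure_queueWait_sub_le hlam hτ_pos hτ_mean hτ_L2 hτ_var hπ hD hL hp
    hν_int hν_mean hc (ε := δ / (2 * (K + 1))) (η := δ / (2 * (C + 1))) (by positivity)
    (by positivity)] with k hk κ
  have hlaw : ∫ ω, f (deterministicWait (D k) lam p r κ ω) ∂(P k) =
      ∫ ω, f (limitQueueWait L lam p r ω) ∂P' :=
    ((identDistrib_deterministicWait (hD k) hL lam r κ).comp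
      hf.continuous.measurable).integral_eq
  rw [← hlaw]
  refine (abs_integral_sub_integral_le
    (measurable_queueWait (hD k).measurable_family (π k) r κ)
    (measurable_deterministicWait (hD k) lam r κ) hf hB hC
    (show 0 ≤ δ / (2 * (K + 1)) by positivity)).trans ?_
  have h1 : (K : ℝ) * (δ / (2 * (K + 1))) ≤ δ / 2 := by
    rw [mul_div_assoc', div_le_div_iff₀ (by positivity) (by positivity)]
    nlinarith
  have h2 : C * (δ / (2 * (C + 1))) ≤ δ / 2 := by
    rw [mul_div_assoc', div_le_div_iff₀ (by positivity) (by positivity)]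
    nlinarith
  have h3 := mul_le_mul_of_nonneg_left (hk κ) hC0
  linarith

/-- A mixture of the waiting times of the queues is close to the mixture of the limits. -/
lemma abs_integral_systemWait_sub_le {k : ℕ} {π : Policy R k} {Ω : Type*} [MeasurableSpace Ω]
    {P : Measure Ω} [IsProbabilityMeasure P] {D : Drivers R k Ω} {τ : Measure ℝ}
    (hD : D.IsSystem P τ ν (period π)) (hπ : π ∈ pPolicies k p)
    {Q : Fin R → Fin k → Finset ℕ} (hQ : IsVisitPartition π Q) (hL : L.IsSystem P' ν p)
    {f : ℝ → ℝ} (hf : Measurable f) {B : ℝ} (hB : ∀ x, |f x| ≤ B) {δ : ℝ} (hδ : 0 ≤ δ)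
    (h : ∀ r κ, |∫ ω, f (queueWait D π r κ ω) ∂P - ∫ ω, f (limitQueueWait L lam p r ω) ∂P'| ≤ δ) :
    |∫ ω, f (systemWait D π Q ω) ∂P - ∫ ω, f (limitWait L lam p ω) ∂P'| ≤ δ := by
  rw [hD.integral_comp_systemWait hπ hQ hf hB, hL.integral_comp_limitWait lam hf hB,
    ← Finset.sum_sub_distrib]
  have hr : ∀ r, |∑ κ, (visitsPerPeriod π r κ : ℝ) / period π * ∫ ω, f (queueWait D π r κ ω) ∂P -
      (p r : ℝ) / l1norm p * ∫ ω, f (limitQueueWait L lam p r ω) ∂P'| ≤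
      (p r : ℝ) / l1norm p * δ := by
    intro r
    -- Splitting `p r / ‖p‖` into the weights of the individual queues reduces the claim to a
    -- termwise comparison.
    rw [← sum_visitsPerPeriod hπ r, Finset.sum_mul, Finset.sum_mul, ← Finset.sum_sub_distrib]
    refine (Finset.abs_sum_le_sum_abs _ _).trans (Finset.sum_le_sum fun κ _ => ?_)
    rw [← mul_sub, abs_mul, abs_of_nonneg (by positivity)]
    gcongr
    exact h r κ
  refine (Finset.abs_sum_le_sum_abs _ _).trans ((Finset.sum_le_sum fun r _ => hr r).trans ?_)
  rw [← Finset.sum_mul, ← Finset.sum_div]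
  have e : ∑ r, (p r : ℝ) = l1norm p := by simp [l1norm]
  rw [e]
  exact mul_le_of_le_one_left hδ (div_self_le_one _)

end Convergence

end ParallelQueues

/-! ### The limit theorem -/

open ParallelQueues in
theorem theorem1
    {R : ℕ} (p : Fin R → ℕ) (hp : ∀ r, 0 < p r)
    (lam : ℝ) (hlam : 0 < lam)
    -- the service times: positive, with mean `1 / μ r` at the queues of type `r`
    (μ : Fin R → ℝ) (hμ : ∀ r, 0 < μ r)
    (ν : Fin R → Measure ℝ) (hν_prob : ∀ r, IsProbabilityMeasure (ν r))
    (hν_pos : ∀ r, ν r (Set.Iic 0) = 0)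
    (hν_int : ∀ r, Integrable (fun x : ℝ => x) (ν r))
    (hν_mean : ∀ r, ∫ x, x ∂(ν r) = (μ r)⁻¹)
    -- the inter-arrival times: positive, with mean `1 / (λ k)` and variance `o(1 / k)`
    (τ : ℕ+ → Measure ℝ) (hτ_prob : ∀ k, IsProbabilityMeasure (τ k))
    (hτ_pos : ∀ k, τ k (Set.Iic 0) = 0)
    (hτ_int : ∀ k, Integrable (fun x : ℝ => x) (τ k))
    (hτ_mean : ∀ k : ℕ+, ∫ x, x ∂(τ k) = (lam * (k : ℝ))⁻¹)
    (hτ_L2 : ∀ᶠ k in atTop, MemLp (fun x : ℝ => x) 2 (τ k))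
    (hτ_var : (fun k : ℕ+ => variance (fun x : ℝ => x) (τ k)) =o[atTop]
      (fun k : ℕ+ => 1 / (k : ℝ)))
    -- stability
    (hstab : ∀ r, lam * ((p r : ℝ) / (l1norm p : ℝ)) < μ r)
    -- the policies
    (π : (k : ℕ+) → Policy R k) (hπ : ∀ k : ℕ+, π k ∈ cyclicPolicies (k : ℕ) p)
    -- the system with `k` queues of each type
    {Ω : ℕ+ → Type*} [∀ k, MeasurableSpace (Ω k)]
    (P : (k : ℕ+) → Measure (Ω k)) [∀ k, IsProbabilityMeasure (P k)]
    (D : (k : ℕ+) → Drivers R k (Ω k))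
    (hD : ∀ k, (D k).IsSystem (P k) (τ k) ν (period (π k)))
    (Q : (k : ℕ+) → Fin R → Fin k → Finset ℕ) (hQ : ∀ k, IsVisitPartition (π k) (Q k))
    -- the limit
    {Ω' : Type*} [MeasurableSpace Ω'] (P' : Measure Ω') [IsProbabilityMeasure P']
    (L : LimitDrivers R Ω') (hL : L.IsSystem P' ν p) :
    -- the suprema that define the stationary waiting times are almost surely finite
    (∀ (k : ℕ+) (r : Fin R) (κ : Fin k), ∀ᵐ ω ∂(P k), BddAbove (Set.range fun n : ℕ =>
      loynesSum (fun n => (D k).service n r κ) (queueArrival (D k) (π k) r κ) n ω)) ∧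
    (∀ r : Fin R, ∀ᵐ ω ∂P', BddAbove (Set.range fun n : ℕ =>
      loynesSum (fun n => L.service n r) (detArrival Ω' lam p r) n ω)) ∧
    -- convergence in distribution
    TendstoInDistribution (fun k : ℕ+ => systemWait (D k) (π k) (Q k)) atTop
      (limitWait L lam p) P P' := by
  have hc : ∀ r, ∫ x, x ∂(ν r) < (l1norm p : ℝ) / ((p r : ℝ) * lam) := by
    intro r
    have h1 : (0 : ℝ) < p r := by exact_mod_cast hp r
    have h2 : (0 : ℝ) < l1norm p := by
      have : p r ≤ l1norm p := Finset.single_le_sum (fun _ _ => Nat.zero_le _) (Finset.mem_univ r)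
      exact_mod_cast (hp r).trans_le this
    rw [hν_mean, ← inv_div]
    refine inv_strictAnti₀ (by positivity) ?_
    calc (p r : ℝ) * lam / l1norm p = lam * ((p r : ℝ) / l1norm p) := by ring
      _ < μ r := hstab r
  have hpos : ∀ r, 0 < ∫ x, x ∂(ν r) := fun r => by
    rw [hν_mean]
    exact inv_pos.2 (hμ r)
  refine ⟨fun k r κ => ae_bddAbove_loynesSum_queue (hD k) (hπ k) (hτ_int k) (hτ_mean k)
    (hν_int r) (hp r) (hc r) κ, fun r => ae_bddAbove_loynesSum_const
    (fun n => hL.measurable_service n r) (fun n => hL.law_service n r) (hL.indep_service_queue r)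
    (hν_int r) (hc r), ?_⟩
  have hmeas : ∀ k, Measurable (systemWait (D k) (π k) (Q k)) := fun k =>
    (hD k).measurable_systemWait (π k) (Q k)
  have hmeas' : Measurable (limitWait L lam p) := hL.measurable_limitWait lam
  refine ⟨fun k => (hmeas k).aemeasurable, hmeas'.aemeasurable, ?_⟩
  refine tendsto_iff_forall_lipschitz_integral_tendsto.2 ?_
  rintro f ⟨C, hC⟩ ⟨K, hf⟩
  -- Boundedness of the Lipschitz test function is supplied as bounded oscillation, so a bound on
  -- `|f|` is recovered from its value at `0`.
  have hB : ∀ x, |f x| ≤ |f 0| + C := fun x => by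
    have h1 := hC x 0
    rw [Real.dist_eq] at h1
    have h2 := abs_sub_abs_le_abs_sub (f x) (f 0)
    linarith
  have hfm := hf.continuous.measurable
  simp only [ProbabilityMeasure.coe_mk]
  rw [integral_map hmeas'.aemeasurable hfm.aestronglyMeasurable]
  simp only [integral_map (hmeas _).aemeasurable hfm.aestronglyMeasurable]
  rw [Metric.tendsto_nhds]
  intro δ hδ
  have hev := eventually_all.2 fun r => eventually_abs_integral_queueWait_sub_le hlam hτ_pos hτ_mean
    hτ_L2 hτ_var hπ hD hL (hp r) (hν_int r) (hpos r) (hc r) hf hB hC (half_pos hδ)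
  filter_upwards [hev] with k hk
  rw [Real.dist_eq]
  exact (abs_integral_systemWait_sub_le (hD k) (hπ k).1 (hQ k) hL hfm hB (half_pos hδ).le
    hk).trans_lt (half_lt_self hδ)
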